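/- **Setting.** A concurrent stochastic game (CSG) $G$ has a finite set of states $S$ with $n=|S|$, finite nonempty action sets $\mathcal A$ and $\mathcal B$ of Player 1 and Player 2, and, for all $(t,a,b)\in S\times\mathcal A\times\mathcal B$, a probability distribution $\delta(t,a,b)$ on $S$; $r\colon S\times\mathcal A\times\mathcal B\to\mathbb R$ is a reward function. The pure stationary strategies of the players are $\Sigma^{PS}=\mathcal A^S$ and $\Gamma^{PS}=\mathcal B^S$. For $\hat\sigma\in\Sigma^{PS}$, $\hat\tau\in\Gamma^{PS}$ let $P^{\hat\sigma,\hat\tau}_{t,t'}=\delta(t,\hat\sigma(t),\hat\tau(t))(t')$ and $r^{\hat\sigma,\hat\tau}_t=r(t,\hat\sigma(t),\hat\tau(t))$. For $\Lambda\colon S\to\mathbb R$ let $$\nabla_\Lambda(\hat\sigma,\hat\tau)=\det\bigl(\mathrm{Id}-((\mathbf 1-\Lambda)\mathbf 1^\top)\odot P^{\hat\sigma,\hat\tau}\bigr),$$ where $\odot$ is the entrywise product, and let $\nabla^s_\Lambda(\hat\sigma,\hat\tau)$ be the determinant of the same matrix with the column of the state $s$ replaced by $\Lambda\odot r^{\hat\sigma,\hat\tau}$.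 For $z\in\mathbb R$, $W^s_\Lambda(z)$ is the matrix game with rows $\Sigma^{PS}$, columns $\Gamma^{PS}$ and entries $$W^s_\Lambda(z)[\hat\sigma,\hat\tau]=\nabla^s_\Lambda(\hat\sigma,\hat\tau)-z\,\nabla_\Lambda(\hat\sigma,\hat\tau),$$ and $\mathrm{val}(M)=\max_x\min_y x^\top My$ (over mixed strategies $x$ of the row player and $y$ of the column player) is the value of a matrix game $M$. Given an assignment function $\chi\colon S\to\{1,\dots,d\}$, discount factors $\lambda_1,\dots,\lambda_d$ define $\Lambda(t)=\lambda_{\chi(t)}$, and the limit function is the iterated limit (innermost in $\lambda_d$) $$F^s_\chi(z)=\lim_{\lambda_1\to0^+}\cdots\lim_{\lambda_d\to0^+}\frac{\mathrm{val}(W^s_\Lambda(z))}{(\lambda_d)^n}\in\mathbb R\cup\{-\infty,+\infty\}.$$ Write $\mathrm{bit}(k)=\lceil\log_2(k+1)\rceil$ for an integer $k\ge0$. **Lemma.** Let $G$ be a CSG, $s$ a state, $r$ a reward function, $\chi\colon S\to\{1,\dots,d\}$ an assignment function and $\mathrm B,\kappa\ge0$ integers. Assume that the transition probabilities and the rewards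 are represented by rational numbers of bit-size $\mathrm B$, that is, they can all be written as fractions $k/N$ with one common denominator $N$, $1\le N\le2^{\mathrm B}$ (for example $N=2^{\mathrm B}$), and integers $|k|\le2^{\mathrm B}$. Let $z$ be a rational number of bit-size $\kappa$, that is, $z=k_1/k_2$ in lowest terms with $|k_1|\le2^\kappa$ and $1\le k_2\le2^\kappa$ (in particular, every rational with $\mathrm{bit}(|k_1|)+\mathrm{bit}(k_2)\le\kappa$ is allowed). Put $$D=\max\bigl(|\Sigma^{PS}|,|\Gamma^{PS}|\bigr),\qquad \mathrm B_1=11Dn\bigl(\mathrm B+\mathrm{bit}(n)+\mathrm{bit}(D)+\kappa\bigr),\qquad \lambda^0_i=\exp\bigl(-\mathrm B_1(nD+1)^{i-1}\bigr)\quad(1\le i\le d),$$ and $\Lambda^0(t)=\lambda^0_{\chi(t)}$. Then the limit $F^s_\chi(z)$ exists in $\mathbb R\cup\{-\infty,+\infty\}$, and - if $\mathrm{val}(W^s_{\Lambda^0}(z))>0$, then $F^s_\chi(z)\ge0$; - if $\mathrm{val}(W^s_{\Lambda^0}(z))<0$, then $F^s_\chi(z)\le0$; - if $\mathrm{val}(W^s_{\Lambda^0}(z))=0$,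 then $F^s_\chi(z)=0$. -/

import Mathlib

open Filter Topology
open scoped Matrix

noncomputable section

/-- `⌈log₂ (k + 1)⌉`, the number of binary digits of `k`. -/
def bitLength (k : ℕ) : ℕ := ⌈Real.logb 2 ((k : ℝ) + 1)⌉₊

/-- The bit-size of a rational `k₁ / k₂` in lowest terms: the bits of numerator and denominator
together. -/
def ratBitLength (q : ℚ) : ℕ := bitLength q.num.natAbs + bitLength q.den

/-- `q` is a rational number of bit-size (at most) `κ`: numerator and denominator, in lowest terms,
are at most `2 ^ κ` in absolute value. This holds for every `q` with `ratBitLength q ≤ κ`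
(`ratHasBitSize_of_ratBitLength_le`), and also for the fractions `j / 2 ^ κ` in `[0, 1]`. -/
def RatHasBitSize (q : ℚ) (κ : ℕ) : Prop := q.num.natAbs ≤ 2 ^ κ ∧ q.den ≤ 2 ^ κ

theorem le_two_pow_of_bitLength_le {k κ : ℕ} (h : bitLength k ≤ κ) : k ≤ 2 ^ κ := by
  have h1 : Real.logb 2 ((k : ℝ) + 1) ≤ κ := (Nat.ceil_le).1 h
  have h2 : ((k : ℝ) + 1) ≤ 2 ^ (κ : ℝ) :=
    (Real.logb_le_iff_le_rpow (by norm_num) (by positivity)).1 h1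
  rw [Real.rpow_natCast] at h2
  have h3 : k + 1 ≤ 2 ^ κ := by exact_mod_cast h2
  omega

theorem ratHasBitSize_of_ratBitLength_le {q : ℚ} {κ : ℕ} (h : ratBitLength q ≤ κ) :
    RatHasBitSize q κ := by
  unfold ratBitLength at h
  exact ⟨le_two_pow_of_bitLength_le (by omega), le_two_pow_of_bitLength_le (by omega)⟩

theorem ratHasBitSize_dyadic {j κ : ℕ} (h : j ≤ 2 ^ κ) :
    RatHasBitSize ((j : ℚ) / 2 ^ κ) κ := by
  have e : ((j : ℚ) / 2 ^ κ) = ((j : ℤ) : ℚ) / (((2 ^ κ : ℕ) : ℤ) : ℚ) := by push_cast; rfl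
  have hp : 0 < 2 ^ κ := by positivity
  rw [RatHasBitSize, e]
  constructor
  · by_cases hj : j = 0
    · simp [hj]
    · have h1 := Rat.num_dvd (j : ℤ) (b := ((2 ^ κ : ℕ) : ℤ)) (by positivity)
      have h2 := Int.natAbs_dvd_natAbs.2 h1
      rw [Rat.intCast_div_eq_divInt]
      exact (Nat.le_of_dvd (by simp; omega) h2).trans (by simpa using h)
  · have h1 := Rat.den_dvd (j : ℤ) ((2 ^ κ : ℕ) : ℤ)
    rw [Rat.intCast_div_eq_divInt]
    exact Nat.le_of_dvd hp (by exact_mod_cast h1)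

/-- A concurrent stochastic game with states `S` and action sets `A₁`, `A₂` of the two players:
for every state and pair of actions, a probability distribution over the successor states. -/
structure ConcurrentGame (S A₁ A₂ : Type*) [Fintype S] where
  prob : S → A₁ → A₂ → stdSimplex ℝ S

/-- The transition probabilities of `G` and the rewards `r` are represented by rational numbers of
bit-size `b`: for some common denominator `N` with `1 ≤ N ≤ 2 ^ b` (for instance `N = 2 ^ b`), all
of them are fractions `k / N` with an integer numerator `k`, `|k| ≤ 2 ^ b`. -/
def ConcurrentGame.HasBitSize {S A₁ A₂ : Type*} [Fintype S] (G : ConcurrentGame S A₁ A₂)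
    (r : S → A₁ → A₂ → ℝ) (b : ℕ) : Prop :=
  ∃ N : ℕ, 1 ≤ N ∧ N ≤ 2 ^ b ∧
    (∀ s i j t, ∃ k : ℤ, |k| ≤ 2 ^ b ∧ (G.prob s i j : S → ℝ) t = (k : ℝ) / (N : ℝ)) ∧
    (∀ s i j, ∃ k : ℤ, |k| ≤ 2 ^ b ∧ r s i j = (k : ℝ) / (N : ℝ))

/-- Stationary strategies: a mixed action for every state. -/
abbrev StationaryStrategy (S A : Type*) [Fintype A] := S → stdSimplex ℝ A

/-- Pure stationary strategies: an action for every state. -/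
abbrev PureStationaryStrategy (S A : Type*) := S → A

open scoped Classical in
/-- A pure stationary strategy, seen as a stationary strategy. -/
def PureStationaryStrategy.toStationary {S A : Type*} [Fintype A]
    (σ : PureStationaryStrategy S A) : StationaryStrategy S A :=
  fun s => ⟨Pi.single (σ s) 1, single_mem_stdSimplex ℝ (σ s)⟩

/-- The transition matrix induced by a pair of stationary strategies. -/
def ConcurrentGame.transMatrix {S A₁ A₂ : Type*} [Fintype S] [Fintype A₁] [Fintype A₂]
    (G : ConcurrentGame S A₁ A₂) (σ : StationaryStrategy S A₁) (τ : StationaryStrategy S A₂) :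
    Matrix S S ℝ :=
  Matrix.of fun s t => ∑ i : A₁, ∑ j : A₂,
    (σ s : A₁ → ℝ) i * (τ s : A₂ → ℝ) j * (G.prob s i j : S → ℝ) t

/-- The stage reward vector induced by a pair of stationary strategies. -/
def stageReward {S A₁ A₂ : Type*} [Fintype A₁] [Fintype A₂]
    (r : S → A₁ → A₂ → ℝ) (σ : StationaryStrategy S A₁) (τ : StationaryStrategy S A₂) : S → ℝ :=
  fun s => ∑ i : A₁, ∑ j : A₂, (σ s : A₁ → ℝ) i * (τ s : A₂ → ℝ) j * r s i j

/-- The matrix `Id - ((1 - Λ) 1ᵀ) ⊙ P^{σ,τ}`. -/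
def ConcurrentGame.discountedMatrix {S A₁ A₂ : Type*} [Fintype S] [DecidableEq S] [Fintype A₁]
    [Fintype A₂] (G : ConcurrentGame S A₁ A₂) (Λ : S → ℝ)
    (σ : StationaryStrategy S A₁) (τ : StationaryStrategy S A₂) : Matrix S S ℝ :=
  1 - (Matrix.vecMulVec (1 - Λ) 1 ⊙ G.transMatrix σ τ)

/-- `∇_Λ(σ, τ)`. -/
def ConcurrentGame.nabla {S A₁ A₂ : Type*} [Fintype S] [DecidableEq S] [Fintype A₁] [Fintype A₂]
    (G : ConcurrentGame S A₁ A₂) (Λ : S → ℝ)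
    (σ : StationaryStrategy S A₁) (τ : StationaryStrategy S A₂) : ℝ :=
  (G.discountedMatrix Λ σ τ).det

/-- `∇_Λ^s(σ, τ)`: the column of the state `s` is replaced by `Λ ⊙ r^{σ,τ}`. -/
def ConcurrentGame.nablaAt {S A₁ A₂ : Type*} [Fintype S] [DecidableEq S] [Fintype A₁] [Fintype A₂]
    (G : ConcurrentGame S A₁ A₂) (r : S → A₁ → A₂ → ℝ) (Λ : S → ℝ) (s : S)
    (σ : StationaryStrategy S A₁) (τ : StationaryStrategy S A₂) : ℝ :=
  ((G.discountedMatrix Λ σ τ).updateCol s (Λ * stageReward r σ τ)).det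

/-- The auxiliary matrix game `W_Λ^s(z)`, whose actions are the pure stationary strategies. -/
def ConcurrentGame.auxGame {S A₁ A₂ : Type*} [Fintype S] [DecidableEq S] [Fintype A₁] [Fintype A₂]
    (G : ConcurrentGame S A₁ A₂) (r : S → A₁ → A₂ → ℝ) (Λ : S → ℝ) (s : S) (z : ℝ) :
    Matrix (PureStationaryStrategy S A₁) (PureStationaryStrategy S A₂) ℝ :=
  Matrix.of fun σ τ =>
    G.nablaAt r Λ s σ.toStationary τ.toStationary - z * G.nabla Λ σ.toStationary τ.toStationary

/-- The value of the matrix game `M`: the largest amount that the row player (the maximizer) can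
guarantee with a mixed strategy `x`, whatever the mixed strategy `y` of the column player. -/
def matrixGameValue {I J : Type*} [Fintype I] [Fintype J] (M : Matrix I J ℝ) : ℝ :=
  ⨆ x : stdSimplex ℝ I, ⨅ y : stdSimplex ℝ J, (x : I → ℝ) ⬝ᵥ (M *ᵥ (y : J → ℝ))

/-- `lim_{x₁ → 0⁺} ⋯ lim_{x_d → 0⁺} f(x₁, …, x_d)` exists in `[-∞, +∞]` and equals `L`.
The limit in the last variable is the innermost one; each inner limit has to exist for all
sufficiently small positive values of the next outer variable. -/
def HasIteratedLimit : (d : ℕ) → ((Fin d → ℝ) → EReal) → EReal → Prop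
  | 0, f, L => f Fin.elim0 = L
  | d + 1, f, L => ∃ g : ℝ → EReal,
      (∀ᶠ x in 𝓝[>] (0 : ℝ), HasIteratedLimit d (fun v => f (Fin.cons x v)) (g x)) ∧
      Tendsto g (𝓝[>] (0 : ℝ)) (𝓝 L)

/-- The iterated limit `lim_{x₁ → 0⁺} ⋯ lim_{x_d → 0⁺} f(x₁, …, x_d)` (meaningful if it exists). -/
def iteratedLimit : (d : ℕ) → ((Fin d → ℝ) → EReal) → EReal
  | 0, f => f Fin.elim0
  | d + 1, f => limUnder (𝓝[>] (0 : ℝ)) fun x => iteratedLimit d (fun v => f (Fin.cons x v))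

/-- If the iterated limit exists, then `iteratedLimit` is its value. -/
theorem HasIteratedLimit.iteratedLimit_eq : ∀ {d : ℕ} {f : (Fin d → ℝ) → EReal} {L : EReal},
    HasIteratedLimit d f L → iteratedLimit d f = L
  | 0, _, _, h => h
  | _ + 1, _, _, ⟨_, hg, hL⟩ =>
      (hL.congr' (hg.mono fun _ hx => (HasIteratedLimit.iteratedLimit_eq hx).symm)).limUnder_eq

/-- `val(W_Λ^s(z)) / (λ_d)^n` as a function of the discount factors `λ₁, …, λ_d`, where the state
`t` has the discount factor `λ_{χ(t)}` and `n` is the number of states. -/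
def ConcurrentGame.limitRatio {S A₁ A₂ : Type*} [Fintype S] [DecidableEq S] [Fintype A₁]
    [Fintype A₂] (G : ConcurrentGame S A₁ A₂) (r : S → A₁ → A₂ → ℝ) {d : ℕ} [NeZero d]
    (χ : S → Fin d) (s : S) (z : ℝ) (lam : Fin d → ℝ) : EReal :=
  ((matrixGameValue (G.auxGame r (fun t => lam (χ t)) s z) /
    lam (⊤ : Fin d) ^ Fintype.card S : ℝ) : EReal)

/-- The limit function `F_χ^s`. -/
def ConcurrentGame.limitFunction {S A₁ A₂ : Type*} [Fintype S] [DecidableEq S] [Fintype A₁]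
    [Fintype A₂] (G : ConcurrentGame S A₁ A₂) (r : S → A₁ → A₂ → ℝ) {d : ℕ} [NeZero d]
    (χ : S → Fin d) (s : S) (z : ℝ) : EReal :=
  iteratedLimit d (G.limitRatio r χ s z)

/-- `exp(-B₁ (n D + 1)^{i-1})` with `B₁ = 11 D n (b + bit(n) + bit(D) + κ)`; the index `i` of `Fin d`
starts at `0`. -/
def explicitFactor (n D b κ : ℕ) {d : ℕ} (i : Fin d) : ℝ :=
  Real.exp (-((11 * D * n * (b + bitLength n + bitLength D + κ) : ℕ) : ℝ) *
    ((n : ℝ) * (D : ℝ) + 1) ^ (i : ℕ))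

end

/-! Multiplied by `z.den * N ^ n`, the game W becomes a matrix of integer polynomials in λ_1, …,
λ_d, of degree at most n in each variable and with a bounded sum E of absolute coefficients
(`polyBound_auxGamePoly`). By Shapley and Snow (`exists_kernel_matrixGameValue`), the value at every
point is a quotient det K / det K' for some square submatrix K and its bordered matrix K'. So
finitely many rational functions cover the value, and their numerators and denominators have degree
at most nD per variable and coefficient sum at most F = (D+1)! E^D.

The second ingredient is the region 0 < λ_i ≤ ε ∏_{j<i} λ_j^m. There, two distinct monomials of
degree at most m per variable differ by a factor of at least 1/ε, so if ε F < 1 the largest monomial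
of a nonzero polynomial outweighs all the others and the polynomial has no zero
(`aeval_ne_zero_of_mem_lexRegion`). In logarithmic coordinates the region is convex, hence it is
connected. Since the value is continuous and each covering function vanishes everywhere or nowhere,
the value has one sign on the whole region (`sign_value_evalMatrix`).

With m = nD and ε = exp(-B₁), the estimate F ≤ 2^B₁ < e^B₁ gives ε F < 1, and the point λ⁰ satisfies
all the inequalities of the region with equality (`explicitFactor_mem_lexRegion`). The region also
contains the points over which the iterated limit is taken, so the sign at λ⁰ passes to the limit in
its weak form; division by λ_d^n > 0 is harmless.

For existence of the limit, the same connectedness argument, applied to differences of kernels on a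
smaller region, shows that one single rational function equals the value there
(`iteratedEventually_value_eq_div`). Iterated limits of rational functions exist by induction on the
number of variables (`exists_hasIteratedLimit_div`). -/

noncomputable section

/-! ### Optimal strategies and continuity of the value of a matrix game. -/

section MatrixGame

variable {I J : Type*} [Fintype I] [Fintype J]

/-- The payoff is linear in `y`, so the pure columns are the only constraints. This replaces the
infimum over a simplex by finitely many inequalities. -/
theorem le_iInf_payoff_iff [Nonempty J] (M : Matrix I J ℝ) (x : I → ℝ) (c : ℝ) :
    c ≤ ⨅ y : stdSimplex ℝ J, x ⬝ᵥ (M *ᵥ (y : J → ℝ)) ↔ ∀ j, c ≤ (x ᵥ* M) j := by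
  classical
  have hbdd : BddBelow (Set.range fun y : stdSimplex ℝ J => x ⬝ᵥ (M *ᵥ (y : J → ℝ))) := by
    have : Continuous fun y : stdSimplex ℝ J => x ⬝ᵥ (M *ᵥ (y : J → ℝ)) := by fun_prop
    exact (isCompact_range this).bddBelow
  have : Nonempty (stdSimplex ℝ J) :=
    ⟨⟨_, single_mem_stdSimplex ℝ (Classical.arbitrary J)⟩⟩
  constructor
  · intro h j
    refine (h.trans (ciInf_le hbdd ⟨_, single_mem_stdSimplex ℝ j⟩)).trans (le_of_eq ?_)
    rw [Matrix.dotProduct_mulVec]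
    simp
  · intro h
    refine le_ciInf fun y => ?_
    rw [Matrix.dotProduct_mulVec]
    calc c = ∑ j, c * (y : J → ℝ) j := by
          rw [← Finset.mul_sum, show ∑ j, (y : J → ℝ) j = 1 from y.2.2, mul_one]
      _ ≤ ∑ j, (x ᵥ* M) j * (y : J → ℝ) j :=
        Finset.sum_le_sum fun j _ => mul_le_mul_of_nonneg_right (h j) (y.2.1 j)

theorem bddAbove_range_iInf_payoff [Nonempty J] (M : Matrix I J ℝ) :
    BddAbove (Set.range fun x : stdSimplex ℝ I =>
      ⨅ y : stdSimplex ℝ J, (x : I → ℝ) ⬝ᵥ (M *ᵥ (y : J → ℝ))) := by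
  have j : J := Classical.arbitrary J
  have hc : Continuous fun x : stdSimplex ℝ I => ((x : I → ℝ) ᵥ* M) j := by
    unfold Matrix.vecMul; fun_prop
  obtain ⟨K, hK⟩ := (isCompact_range hc).bddAbove
  refine ⟨K, ?_⟩
  rintro _ ⟨x, rfl⟩
  exact ((le_iInf_payoff_iff M x _).1 le_rfl j).trans (hK ⟨x, rfl⟩)

theorem le_matrixGameValue [Nonempty J] (M : Matrix I J ℝ) {x : I → ℝ}
    (hx : x ∈ stdSimplex ℝ I) {c : ℝ} (h : ∀ j, c ≤ (x ᵥ* M) j) : c ≤ matrixGameValue M :=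
  le_ciSup_of_le (bddAbove_range_iInf_payoff M) ⟨x, hx⟩ ((le_iInf_payoff_iff M x c).2 h)

theorem exists_optimal_strategy [Nonempty I] [Nonempty J] (M : Matrix I J ℝ) :
    ∃ x ∈ stdSimplex ℝ I, ∀ j, matrixGameValue M ≤ (x ᵥ* M) j := by
  classical
  have hc : Continuous fun x : I → ℝ =>
      Finset.univ.inf' Finset.univ_nonempty fun j => (x ᵥ* M) j := by
    refine Continuous.finset_inf'_apply _ fun j _ => ?_
    unfold Matrix.vecMul; fun_prop
  obtain ⟨x, hx, hmax⟩ := (isCompact_stdSimplex ℝ I).exists_isMaxOn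
    ⟨_, single_mem_stdSimplex ℝ (Classical.arbitrary I)⟩ hc.continuousOn
  refine ⟨x, hx, fun j => ?_⟩
  have : Nonempty (stdSimplex ℝ I) := ⟨⟨x, hx⟩⟩
  refine ciSup_le fun x' => ?_
  refine le_trans ?_ (Finset.inf'_le (f := fun j => (x ᵥ* M) j) (Finset.mem_univ j))
  refine le_trans ?_ (hmax x'.2)
  exact Finset.le_inf' _ _ fun j _ => (le_iInf_payoff_iff M x' _).1 le_rfl j

theorem matrixGameValue_smul [Nonempty I] [Nonempty J] (M : Matrix I J ℝ) {t : ℝ} (ht : 0 < t) :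
    matrixGameValue (t • M) = t * matrixGameValue M := by
  have key : ∀ (M : Matrix I J ℝ) {t : ℝ}, 0 < t →
      t * matrixGameValue M ≤ matrixGameValue (t • M) := by
    intro M t ht
    obtain ⟨x, hx, h⟩ := exists_optimal_strategy M
    refine le_matrixGameValue _ hx fun j => ?_
    rw [Matrix.vecMul_smul]
    exact mul_le_mul_of_nonneg_left (h j) ht.le
  refine le_antisymm ?_ (key M ht)
  have := key (t • M) (inv_pos.2 ht)
  rw [smul_smul, inv_mul_cancel₀ ht.ne', one_smul] at this
  calc _ = t * (t⁻¹ * matrixGameValue (t • M)) := by field_simp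
    _ ≤ _ := mul_le_mul_of_nonneg_left this ht.le

/-- An optimal strategy for `M` loses at most `ε` in `M'`. Used in both directions, this is the
continuity of the value. -/
theorem matrixGameValue_le_add [Nonempty I] [Nonempty J] (M M' : Matrix I J ℝ) {ε : ℝ}
    (h : ∀ i j, M i j ≤ M' i j + ε) : matrixGameValue M ≤ matrixGameValue M' + ε := by
  obtain ⟨x, hx, hM⟩ := exists_optimal_strategy M
  suffices matrixGameValue M - ε ≤ matrixGameValue M' by linarith
  refine le_matrixGameValue M' hx fun j => ?_
  have : (x ᵥ* M) j ≤ (x ᵥ* M') j + ε := by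
    calc (x ᵥ* M) j ≤ ∑ i, x i * (M' i j + ε) :=
          Finset.sum_le_sum fun i _ => mul_le_mul_of_nonneg_left (h i j) (hx.1 i)
      _ = (x ᵥ* M') j + ε := by
        simp only [mul_add, Finset.sum_add_distrib, ← Finset.sum_mul, hx.2, one_mul]; rfl
  linarith [hM j]

theorem continuous_matrixGameValue [Nonempty I] [Nonempty J] :
    Continuous (matrixGameValue : Matrix I J ℝ → ℝ) := by
  rw [continuous_iff_continuousAt]
  intro M
  rw [ContinuousAt, Metric.tendsto_nhds]
  intro ε hε
  have h1 : ∀ i j, ∀ᶠ M' : Matrix I J ℝ in 𝓝 M, |M' i j - M i j| < ε / 2 := by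
    intro i j
    have : Continuous fun M' : Matrix I J ℝ => M' i j := by fun_prop
    exact (Metric.tendsto_nhds.1 this.continuousAt) (ε / 2) (by positivity)
  have h2 : ∀ᶠ M' : Matrix I J ℝ in 𝓝 M, ∀ i j, |M' i j - M i j| < ε / 2 := by
    simpa only [eventually_all] using h1
  filter_upwards [h2] with M' hM'
  have a := matrixGameValue_le_add M M' (ε := ε / 2)
    fun i j => by linarith [(abs_lt.1 (hM' i j)).1]
  have b := matrixGameValue_le_add M' M (ε := ε / 2)
    fun i j => by linarith [(abs_lt.1 (hM' i j)).2]
  rw [Real.dist_eq, abs_lt]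
  constructor <;> linarith

end MatrixGame

/-! ### The Shapley–Snow formula. -/

section Kernel

/-- The square matrix `K`, bordered by a column of ones, a row of minus ones and a zero. -/
def borderedMatrix {m R : Type*} [CommRing R] (K : Matrix m m R) : Matrix (m ⊕ Unit) (m ⊕ Unit) R :=
  Matrix.fromBlocks K (Matrix.of fun _ _ => 1) (Matrix.of fun _ _ => -1) 0

/-- Multiplying the bordered matrix on the left by the block matrix with last row `(x, v)` turns its
last row into `(0, 1)`, and the multiplier has determinant `v`. Without assuming `K` regular, this
identifies `v` as a quotient once the bordered determinant is nonzero. -/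
theorem det_eq_mul_det_borderedMatrix {m R : Type*} [Fintype m] [DecidableEq m] [CommRing R]
    (K : Matrix m m R) {x : m → R} {v : R} (hx : ∑ i, x i = 1) (hK : ∀ j, (x ᵥ* K) j = v) :
    K.det = v * (borderedMatrix K).det := by
  have h : Matrix.fromBlocks (1 : Matrix m m R) 0 (Matrix.of fun _ i => x i)
      (Matrix.of fun _ _ => v) *
      borderedMatrix K = Matrix.fromBlocks K (Matrix.of fun _ _ => 1) 0 (1 : Matrix Unit Unit R) := by
    rw [borderedMatrix, Matrix.fromBlocks_multiply]
    congr 1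
    · simp
    · simp
    · ext i j
      have := hK j
      simp only [Matrix.vecMul, dotProduct] at this
      simp [Matrix.mul_apply, this]
    · ext i j
      simp [Matrix.mul_apply, hx]
  have := congrArg Matrix.det h
  rw [Matrix.det_mul, Matrix.det_fromBlocks_zero₁₂, Matrix.det_fromBlocks_zero₂₁] at this
  simpa using this.symm

/-- A basis is extracted from a spanning family with one prescribed member. That member will be the
border column of ones. -/
theorem exists_subset_span_eq_top_of_mem {ι V : Type*} [Finite ι] [AddCommGroup V] [Module ℝ V]
    [FiniteDimensional ℝ V] (f : ι → V) {t : Set ι} {c : ι} (hc : c ∈ t) (hfc : f c ≠ 0)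
    (ht : Submodule.span ℝ (f '' t) = ⊤) :
    ∃ s ⊆ t, c ∈ s ∧ s.ncard = Module.finrank ℝ V ∧ Submodule.span ℝ (f '' s) = ⊤ := by
  have hli : LinearIndepOn ℝ f {c} := by simpa using hfc
  have hsub : ({c} : Set ι) ⊆ t := by simpa using hc
  have hspan : Submodule.span ℝ (f '' hli.extend hsub) = ⊤ :=
    (hli.span_image_extend_eq_span_image hsub).trans ht
  refine ⟨hli.extend hsub, hli.extend_subset hsub, hli.subset_extend hsub rfl, ?_, hspan⟩
  have h := hli.linearIndepOn_extend hsub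
  let b := Module.Basis.mk (v := fun i : hli.extend hsub => f i) h (by
    rw [← Set.image_eq_range]; exact hspan.ge)
  rw [Module.finrank_eq_nat_card_basis b, Nat.card_coe_set_eq]

theorem span_eq_top_of_dotProduct {m : Type*} [Fintype m] (s : Set (m → ℝ))
    (h : ∀ u : m → ℝ, (∀ w ∈ s, u ⬝ᵥ w = 0) → u = 0) : Submodule.span ℝ s = ⊤ := by
  classical
  by_contra hne
  obtain ⟨φ, hφ, hle⟩ := Submodule.exists_le_ker_of_lt_top _ (lt_top_iff_ne_top.2 hne)
  have hu : ∀ w : m → ℝ, φ w = (fun i => φ (Pi.single i 1)) ⬝ᵥ w := by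
    intro w
    rw [LinearMap.pi_apply_eq_sum_univ φ w]
    simp only [dotProduct, smul_eq_mul, mul_comm]
    refine Finset.sum_congr rfl fun i _ => ?_
    congr 2
    ext j
    simp [Pi.single_apply, eq_comm]
  have h0 := h _ fun w hw => (hu w).symm.trans (hle (Submodule.subset_span hw))
  apply hφ
  exact LinearMap.ext fun w => by rw [hu, h0, zero_dotProduct, LinearMap.zero_apply]

theorem eq_zero_of_span_eq_top {m : Type*} [Fintype m] {s : Set (m → ℝ)}
    (hs : Submodule.span ℝ s = ⊤) {u : m → ℝ} (h : ∀ w ∈ s, u ⬝ᵥ w = 0) : u = 0 := by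
  have : ∀ w ∈ Submodule.span ℝ s, u ⬝ᵥ w = 0 := by
    intro w hw
    induction hw using Submodule.span_induction with
    | mem w hw => exact h w hw
    | zero => simp
    | add a b _ _ ha hb => rw [dotProduct_add, ha, hb, add_zero]
    | smul c a _ ha => rw [dotProduct_smul, ha, smul_zero]
  exact dotProduct_self_eq_zero.1 (this u (hs ▸ Submodule.mem_top))

/-- If no nonzero row vector annihilates the ones column and the columns `(M j, -1)`, `j ∈ B`,
then `M` has a maximal square submatrix with columns in `B` whose bordered matrix is regular. -/
theorem exists_det_borderedMatrix_ne_zero {X J : Type*} [Fintype X] [DecidableEq X] [Nonempty X]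
    [Finite J] (M : Matrix X J ℝ) (B : Set J)
    (h : ∀ (u : X → ℝ) (w : ℝ), ∑ i, u i = 0 → (∀ j ∈ B, (u ᵥ* M) j = w) → u = 0 ∧ w = 0) :
    ∃ e : X → J, (∀ i, e i ∈ B) ∧ (borderedMatrix (M.submatrix id e)).det ≠ 0 := by
  classical
  let f : Option J → (X ⊕ Unit → ℝ) := fun o =>
    o.elim (Sum.elim (fun _ => 1) 0) fun j => Sum.elim (fun i => M i j) (fun _ => -1)
  have hnone : ∀ u : X ⊕ Unit → ℝ, u ⬝ᵥ f none = ∑ i, u (Sum.inl i) := by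
    intro u; simp [f, dotProduct]
  have hsome : ∀ (u : X ⊕ Unit → ℝ) j,
      u ⬝ᵥ f (some j) = ((fun i => u (Sum.inl i)) ᵥ* M) j - u (Sum.inr ()) := by
    intro u j; simp [f, dotProduct, Matrix.vecMul, sub_eq_add_neg]
  have hspan : Submodule.span ℝ (f '' insert none (some '' B)) = ⊤ := by
    refine span_eq_top_of_dotProduct _ fun u hu => ?_
    have h1 := hu (f none) ⟨none, by simp, rfl⟩
    rw [hnone] at h1
    obtain ⟨h2, h3⟩ := h (fun i => u (Sum.inl i)) (u (Sum.inr ())) h1 fun j hj => by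
      have := hu (f (some j)) ⟨some j, by simp [hj], rfl⟩
      rw [hsome] at this
      linarith
    ext i
    rcases i with i | i
    · exact congrFun h2 i
    · exact h3
  have hne : f none ≠ 0 := fun h0 => by
    have := congrFun h0 (Sum.inl (Classical.arbitrary X))
    simp [f] at this
  -- The ambient dimension is |X| + 1 and the ones column takes one place, so exactly |X| columns of
  -- `M` remain: the kernel is square.
  obtain ⟨s, hst, hns, hcard, hs⟩ :=
    exists_subset_span_eq_top_of_mem f (Set.mem_insert _ _) hne hspan
  have hs' : s = insert none (some '' (some ⁻¹' s)) := by
    ext o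
    cases o <;> simp [hns]
  have hcard' : (some ⁻¹' s : Set J).ncard = Fintype.card X := by
    rw [hs', Set.ncard_insert_of_notMem (by simp) (Set.toFinite _),
      Set.ncard_image_of_injective _ (Option.some_injective J)] at hcard
    simpa using hcard
  obtain ⟨e⟩ : Nonempty (X ≃ (some ⁻¹' s : Set J)) := by
    have := Fintype.ofFinite (some ⁻¹' s : Set J)
    refine ⟨Fintype.equivOfCardEq ?_⟩
    rw [← hcard', ← Nat.card_coe_set_eq, Nat.card_eq_fintype_card]
  refine ⟨fun i => e i, fun i => ?_, fun hdet => ?_⟩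
  · simpa using hst (e i).2
  · obtain ⟨u, hu, hu0⟩ := Matrix.exists_vecMul_eq_zero_iff.2 hdet
    refine hu (eq_zero_of_span_eq_top hs ?_)
    rintro _ ⟨o, ho, rfl⟩
    cases o with
    | none =>
      have := congrFun hu0 (Sum.inr ())
      simpa [borderedMatrix, Matrix.vecMul, f, dotProduct] using this
    | some j =>
      have := congrFun hu0 (Sum.inl (e.symm ⟨j, ho⟩))
      simpa [borderedMatrix, Matrix.vecMul, f, dotProduct] using this

variable {I J : Type*} [Fintype I] [Fintype J]

/-- The value formula of Shapley and Snow. -/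
theorem exists_kernel_matrixGameValue [DecidableEq I] [Nonempty I] [Nonempty J]
    (M : Matrix I J ℝ) :
    ∃ (X : Finset I) (e : X → J), (borderedMatrix (M.submatrix Subtype.val e)).det ≠ 0 ∧
      matrixGameValue M = (M.submatrix Subtype.val e).det /
        (borderedMatrix (M.submatrix Subtype.val e)).det := by
  classical
  set v := matrixGameValue M with hv
  let O : Set (I → ℝ) := {x | x ∈ stdSimplex ℝ I ∧ ∀ j, v ≤ (x ᵥ* M) j}
  have hOne : O.Nonempty := by
    obtain ⟨x, hx⟩ := exists_optimal_strategy M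
    exact ⟨x, hx⟩
  have hcont : ∀ j, Continuous fun x : I → ℝ => (x ᵥ* M) j := by
    intro j; unfold Matrix.vecMul; fun_prop
  have hOc : IsCompact O := by
    refine (isCompact_stdSimplex ℝ I).inter_right (t := {x | ∀ j, v ≤ (x ᵥ* M) j}) ?_
    simp only [Set.ofPred_forall]
    exact isClosed_iInter fun j => isClosed_le continuous_const (hcont j)
  -- Extremality among the optimal strategies is what makes the kernel regular: a nonzero direction
  -- in its support preserving all tight payoffs would put `x` inside a segment of optimal
  -- strategies.
  obtain ⟨x, hxO, hext⟩ := hOc.extremePoints_nonempty hOne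
  obtain ⟨hx, hxv⟩ := hxO
  let X : Finset I := Finset.univ.filter fun i => x i ≠ 0
  let B : Set J := {j | (x ᵥ* M) j = v}
  -- a perturbation in a direction supported on `X` stays in the simplex
  have hpert : ∀ h : I → ℝ, (∀ i, x i = 0 → h i = 0) → ∑ i, h i = 0 →
      ∀ᶠ ε in 𝓝[>] (0 : ℝ), x + ε • h ∈ stdSimplex ℝ I := by
    intro h hsupp hsum
    have h1 : ∀ i, ∀ᶠ ε in 𝓝[>] (0 : ℝ), 0 ≤ x i + ε * h i := by
      intro i
      rcases (hx.1 i).eq_or_lt with h0 | h0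
      · simp [← h0, hsupp i h0.symm]
      · have : Tendsto (fun ε : ℝ => x i + ε * h i) (𝓝[>] 0) (𝓝 (x i + 0 * h i)) :=
          Tendsto.mono_left (Continuous.tendsto (by fun_prop) 0) nhdsWithin_le_nhds
        rw [zero_mul, add_zero] at this
        exact (this.eventually (lt_mem_nhds h0)).mono fun _ => le_of_lt
    filter_upwards [eventually_all.2 h1] with ε hε
    refine ⟨fun i => by simpa using hε i, ?_⟩
    simp [Finset.sum_add_distrib, hx.2, ← Finset.mul_sum, hsum]
  have hloose : ∀ h : I → ℝ, ∀ᶠ ε in 𝓝[>] (0 : ℝ), ∀ j ∉ B, v < ((x + ε • h) ᵥ* M) j := by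
    intro h
    have : ∀ j, ∀ᶠ ε in 𝓝[>] (0 : ℝ), j ∉ B → v < ((x + ε • h) ᵥ* M) j := by
      intro j
      by_cases hj : j ∈ B
      · simp [hj]
      · have hlt : v < (x ᵥ* M) j := lt_of_le_of_ne (hxv j) fun h => hj h.symm
        have : Tendsto (fun ε : ℝ => ((x + ε • h) ᵥ* M) j) (𝓝[>] 0)
            (𝓝 (((x + (0 : ℝ) • h) ᵥ* M) j)) :=
          Tendsto.mono_left (Continuous.tendsto ((hcont j).comp (by fun_prop)) 0)
            nhdsWithin_le_nhds
        rw [zero_smul, add_zero] at this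
        exact (this.eventually (lt_mem_nhds hlt)).mono fun _ h _ => h
    exact eventually_all.2 this
  have hlin : ∀ (h : I → ℝ) (ε : ℝ) j, ((x + ε • h) ᵥ* M) j = (x ᵥ* M) j + ε * (h ᵥ* M) j := by
    intro h ε j
    simp [Matrix.add_vecMul, Matrix.smul_vecMul]
  -- no direction improves all tight columns
  have hpos : ∀ (h : I → ℝ) (w : ℝ), (∀ i, x i = 0 → h i = 0) → ∑ i, h i = 0 →
      (∀ j ∈ B, (h ᵥ* M) j = w) → w ≤ 0 := by
    intro h w hsupp hsum hw
    by_contra! hwpos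
    obtain ⟨ε, ⟨h1, h2⟩, h3⟩ := (((hpert h hsupp hsum).and (hloose h)).and
      self_mem_nhdsWithin).exists
    have h4 : ∀ j, v < ((x + ε • h) ᵥ* M) j := by
      intro j
      by_cases hj : j ∈ B
      · rw [hlin, hw j hj, show (x ᵥ* M) j = v from hj]
        have : 0 < ε * w := mul_pos h3 hwpos
        linarith
      · exact h2 j hj
    obtain ⟨j0, -, hj0⟩ := Finset.exists_min_image Finset.univ
      (fun j => ((x + ε • h) ᵥ* M) j) Finset.univ_nonempty
    exact absurd (le_matrixGameValue M h1 fun j => hj0 j (Finset.mem_univ j)) (not_le.2 (h4 j0))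
  have hBne : B.Nonempty := by
    by_contra hB
    rw [Set.not_nonempty_iff_eq_empty] at hB
    have := hpos 0 1 (by simp) (by simp) (by simp [hB])
    linarith
  have hker : ∀ (h : I → ℝ) (w : ℝ), (∀ i, x i = 0 → h i = 0) → ∑ i, h i = 0 →
      (∀ j ∈ B, (h ᵥ* M) j = w) → h = 0 ∧ w = 0 := by
    intro h w hsupp hsum hw
    have hsupp' : ∀ i, x i = 0 → (-h) i = 0 := fun i hi => by simp [hsupp i hi]
    have hsum' : ∑ i, (-h) i = 0 := by simp [hsum]
    have hw' : ∀ j ∈ B, ((-h) ᵥ* M) j = -w := fun j hj => by simp [Matrix.neg_vecMul, hw j hj]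
    -- Moving along `h` would raise the value if `w > 0`, and moving along `-h` if `w < 0`.
    have hw0 : w = 0 := le_antisymm (hpos h w hsupp hsum hw)
      (by linarith [hpos (-h) (-w) hsupp' hsum' hw'])
    refine ⟨?_, hw0⟩
    have hmem : ∀ h : I → ℝ, (∀ i, x i = 0 → h i = 0) → ∑ i, h i = 0 →
        (∀ j ∈ B, (h ᵥ* M) j = 0) → ∀ᶠ ε in 𝓝[>] (0 : ℝ), x + ε • h ∈ O := by
      intro h hsupp hsum hw
      filter_upwards [hpert h hsupp hsum, hloose h] with ε h1 h2
      refine ⟨h1, fun j => ?_⟩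
      by_cases hj : j ∈ B
      · rw [hlin, hw j hj, show (x ᵥ* M) j = v from hj]; simp
      · exact (h2 j hj).le
    obtain ⟨ε, ⟨h1, h2⟩, h3⟩ := (((hmem h hsupp hsum (by simpa [hw0] using hw)).and
      (hmem (-h) hsupp' hsum' (by simpa [hw0] using hw'))).and self_mem_nhdsWithin).exists
    have h3' : (0 : ℝ) < ε := h3
    have hseg : x ∈ openSegment ℝ (x + ε • h) (x + ε • (-h)) :=
      ⟨1 / 2, 1 / 2, by norm_num, by norm_num, by norm_num, by
        ext i; simp; ring⟩
    have := hext h1 h2 hseg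
    have : ε • h = 0 := by simpa using this
    exact (smul_eq_zero.1 this).resolve_left h3'.ne'
  have hXne : Nonempty X := by
    by_contra hX
    have : ∀ i, x i = 0 := by
      intro i
      by_contra hi
      exact hX ⟨⟨i, by simp [X, hi]⟩⟩
    have h1 := hx.2
    simp [this] at h1
  have hsumX : ∀ g : I → ℝ, (∀ i, x i = 0 → g i = 0) → ∑ i : X, g i = ∑ i, g i := by
    intro g hg
    rw [Finset.sum_coe_sort X g]
    refine Finset.sum_subset (Finset.subset_univ _) fun i _ hi => hg i ?_
    simpa [X] using hi
  obtain ⟨e, heB, hdet⟩ := exists_det_borderedMatrix_ne_zero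
    (M.submatrix (Subtype.val : X → I) id) B (by
      intro u w hu hw
      let h : I → ℝ := fun i => if hi : i ∈ X then u ⟨i, hi⟩ else 0
      have hsupp : ∀ i, x i = 0 → h i = 0 := by
        intro i hi
        simp [h, X, hi]
      have hh : ∀ i : X, h i = u i := by
        intro i; simp [h]
      obtain ⟨h1, h2⟩ := hker h w hsupp (by
        rw [← hsumX h hsupp, ← hu]; exact Finset.sum_congr rfl fun i _ => hh i) (by
        intro j hj
        rw [← hw j hj]
        simp only [Matrix.vecMul, dotProduct]
        rw [← hsumX _ (fun i hi => by rw [hsupp i hi, zero_mul])]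
        refine Finset.sum_congr rfl fun i _ => ?_
        rw [hh]; rfl)
      refine ⟨?_, h2⟩
      ext i
      rw [← hh, h1]; rfl)
  refine ⟨X, e, hdet, ?_⟩
  have hdet' : (borderedMatrix (M.submatrix Subtype.val e)).det ≠ 0 := hdet
  rw [eq_div_iff hdet']
  refine (det_eq_mul_det_borderedMatrix (M.submatrix Subtype.val e)
    (x := fun i : X => x i) ?_ ?_).symm
  · rw [hsumX x fun _ h => h, hx.2]
  · intro i
    rw [← show (x ᵥ* M) (e i) = v from heB i]
    simp only [Matrix.vecMul, dotProduct]
    rw [← hsumX _ (fun i hi => by rw [hi, zero_mul])]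
    rfl

end Kernel

/-! ### Properties holding along an iterated limit. -/

section IteratedLimit

/-- `p` holds iteratively eventually as `x₁ → 0⁺, …, x_d → 0⁺`. -/
def IteratedEventually : (d : ℕ) → ((Fin d → ℝ) → Prop) → Prop
  | 0, p => p Fin.elim0
  | d + 1, p => ∀ᶠ x in 𝓝[>] (0 : ℝ), IteratedEventually d fun v => p (Fin.cons x v)

theorem IteratedEventually.mono : ∀ {d : ℕ} {p q : (Fin d → ℝ) → Prop},
    IteratedEventually d p → (∀ v, p v → q v) → IteratedEventually d q
  | 0, _, _, h, hpq => hpq _ h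
  | _ + 1, _, _, h, hpq => Eventually.mono h fun _ hx => hx.mono fun _ => hpq _

theorem HasIteratedLimit.congr : ∀ {d : ℕ} {f g : (Fin d → ℝ) → EReal} {L : EReal},
    HasIteratedLimit d f L → IteratedEventually d (fun v => f v = g v) → HasIteratedLimit d g L
  | 0, _, _, _, h, hfg => Eq.trans (Eq.symm hfg) h
  | _ + 1, _, _, _, ⟨u, hu, hL⟩, hfg =>
      ⟨u, (hu.and hfg).mono fun _ hx => hx.1.congr hx.2, hL⟩

theorem HasIteratedLimit.mem_of_isClosed {C : Set EReal} (hC : IsClosed C) :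
    ∀ {d : ℕ} {f : (Fin d → ℝ) → EReal} {L : EReal},
    HasIteratedLimit d f L → IteratedEventually d (fun v => f v ∈ C) → L ∈ C
  | 0, _, _, h, hf => by
    rw [← show _ = _ from h]; exact hf
  | _ + 1, _, _, ⟨_, hu, hL⟩, hf =>
      hC.mem_of_tendsto hL ((hu.and hf).mono fun _ hx => hx.1.mem_of_isClosed hC hx.2)

end IteratedLimit

/-! ### Iterated limits of rational functions. -/

section RationalLimit

open Polynomial

/-- The quotient of `y ^ a * F y` and `y ^ b * H y` has a limit in `[-∞, ∞]` at `0⁺`. -/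
theorem tendsto_pow_mul_div_pow_mul {F H : ℝ → ℝ} {f h : ℝ} (hF : Tendsto F (𝓝[>] 0) (𝓝 f))
    (hH : Tendsto H (𝓝[>] 0) (𝓝 h)) (hh : h ≠ 0) (a b : ℕ) :
    (b < a → Tendsto (fun y : ℝ => ((y ^ a * F y / (y ^ b * H y) : ℝ) : EReal)) (𝓝[>] 0) (𝓝 0)) ∧
    (a = b → Tendsto (fun y : ℝ => ((y ^ a * F y / (y ^ b * H y) : ℝ) : EReal)) (𝓝[>] 0)
      (𝓝 ((f / h : ℝ) : EReal))) ∧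
    (a < b → 0 < f * h → Tendsto (fun y : ℝ => ((y ^ a * F y / (y ^ b * H y) : ℝ) : EReal))
      (𝓝[>] 0) (𝓝 ⊤)) ∧
    (a < b → f * h < 0 → Tendsto (fun y : ℝ => ((y ^ a * F y / (y ^ b * H y) : ℝ) : EReal))
      (𝓝[>] 0) (𝓝 ⊥)) := by
  have hq : Tendsto (fun y => F y / H y) (𝓝[>] 0) (𝓝 (f / h)) := hF.div hH hh
  have hpos : ∀ᶠ y in 𝓝[>] (0 : ℝ), 0 < y := self_mem_nhdsWithin
  have hpow : ∀ k : ℕ, 0 < k → Tendsto (fun y : ℝ => y ^ k) (𝓝[>] 0) (𝓝 0) := by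
    intro k hk
    have : Tendsto (fun y : ℝ => y ^ k) (𝓝 0) (𝓝 (0 ^ k)) := (continuous_pow k).tendsto 0
    rw [zero_pow hk.ne'] at this
    exact this.mono_left nhdsWithin_le_nhds
  have hpowinv : ∀ k : ℕ, 0 < k → Tendsto (fun y : ℝ => (y ^ k)⁻¹) (𝓝[>] 0) atTop := by
    intro k hk
    refine tendsto_inv_nhdsGT_zero.comp (tendsto_nhdsWithin_iff.2 ⟨hpow k hk, ?_⟩)
    filter_upwards [hpos] with y hy using pow_pos hy k
  have hneg : a < b → Tendsto (fun y : ℝ => (y ^ (b - a))⁻¹) (𝓝[>] 0) atTop ∧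
      (fun y : ℝ => y ^ a * F y / (y ^ b * H y)) =ᶠ[𝓝[>] 0]
        fun y => F y / H y * (y ^ (b - a))⁻¹ := by
    intro hab
    refine ⟨hpowinv _ (by omega), ?_⟩
    filter_upwards [hpos] with y hy
    have : y ^ b = y ^ a * y ^ (b - a) := by rw [← pow_add]; congr 1; omega
    rw [this]
    field_simp
  refine ⟨fun hab => ?_, fun hab => ?_, fun hab hfh => ?_, fun hab hfh => ?_⟩
  · rw [← EReal.coe_zero, EReal.tendsto_coe]
    have := (hpow (a - b) (by omega)).mul hq
    rw [zero_mul] at this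
    refine this.congr' ?_
    filter_upwards [hpos] with y hy
    have : y ^ a = y ^ b * y ^ (a - b) := by rw [← pow_add]; congr 1; omega
    rw [this]
    field_simp
  · rw [EReal.tendsto_coe]
    refine hq.congr' ?_
    filter_upwards [hpos] with y hy
    rw [hab]
    field_simp
  · obtain ⟨h1, h2⟩ := hneg hab
    rw [EReal.tendsto_coe_nhds_top_iff]
    have hfh' : 0 < f / h := by
      rcases mul_pos_iff.1 hfh with ⟨h1, h2⟩ | ⟨h1, h2⟩
      · exact div_pos h1 h2
      · exact div_pos_of_neg_of_neg h1 h2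
    exact (hq.pos_mul_atTop hfh' h1).congr' h2.symm
  · obtain ⟨h1, h2⟩ := hneg hab
    rw [EReal.tendsto_coe_nhds_bot_iff]
    have hfh' : f / h < 0 := by
      rcases mul_neg_iff.1 hfh with ⟨h1, h2⟩ | ⟨h1, h2⟩
      · exact div_neg_of_pos_of_neg h1 h2
      · exact div_neg_of_neg_of_pos h1 h2
    exact (hq.neg_mul_atTop hfh' h1).congr' h2.symm

/-- Along `l`, the evaluations `ev` of every nonzero element of `R` have eventually one sign. -/
def HasEventualSigns {R Ω : Type} [CommRing R] (l : Filter Ω) (ev : Ω → R →+* ℝ) : Prop :=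
  ∀ c : R, c ≠ 0 → (∀ᶠ ω in l, 0 < ev ω c) ∨ ∀ᶠ ω in l, ev ω c < 0

theorem exists_eq_X_pow_mul {R : Type*} [CommRing R] [IsDomain R] {p : R[X]} (hp : p ≠ 0) :
    ∃ (k : ℕ) (u : R[X]), p = X ^ k * u ∧ u.coeff 0 ≠ 0 := by
  obtain ⟨u, hu, hdvd⟩ := exists_eq_pow_rootMultiplicity_mul_and_not_dvd p hp 0
  rw [C_0, sub_zero] at hu hdvd
  exact ⟨_, u, hu, fun h => hdvd (X_dvd_iff.2 h)⟩

theorem tendsto_eval₂_coeff_zero {R : Type*} [CommRing R] (φ : R →+* ℝ) (u : R[X]) :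
    Tendsto (fun y => u.eval₂ φ y) (𝓝[>] 0) (𝓝 (φ (u.coeff 0))) := by
  have : Continuous fun y : ℝ => u.eval₂ φ y := by
    simp only [eval₂_eq_eval_map]; exact (u.map φ).continuous
  have h := this.tendsto 0
  rw [eval₂_at_zero] at h
  exact h.mono_left nhdsWithin_le_nhds

/-- After a power of the variable is factored out, the constant term decides the sign. The threshold
for `y` depends on `ω`, hence the curried filter. -/
theorem HasEventualSigns.polynomial {R Ω : Type} [CommRing R] [IsDomain R] {l : Filter Ω}
    {ev : Ω → R →+* ℝ} (h : HasEventualSigns l ev) :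
    HasEventualSigns (l.curry (𝓝[>] (0 : ℝ)))
      (fun ωy : Ω × ℝ => eval₂RingHom (ev ωy.1) ωy.2) := by
  intro p hp
  obtain ⟨k, u, rfl, hu⟩ := exists_eq_X_pow_mul hp
  have hpos : ∀ᶠ y in 𝓝[>] (0 : ℝ), 0 < y := self_mem_nhdsWithin
  simp only [eventually_curry_iff, coe_eval₂RingHom, eval₂_mul, eval₂_X_pow]
  refine (h _ hu).imp (fun h1 => ?_) (fun h1 => ?_)
  · filter_upwards [h1] with ω hω
    filter_upwards [hpos, (tendsto_eval₂_coeff_zero (ev ω) u).eventually (lt_mem_nhds hω)]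
      with y hy h2 using mul_pos (pow_pos hy k) h2
  · filter_upwards [h1] with ω hω
    filter_upwards [hpos, (tendsto_eval₂_coeff_zero (ev ω) u).eventually (gt_mem_nhds hω)]
      with y hy h2 using mul_neg_of_pos_of_neg (pow_pos hy k) h2

/-- Isolating the first variable as the variable of the coefficient ring. -/
def firstVariableToCoeff (d : ℕ) (R : Type) [CommRing R] :
    MvPolynomial (Fin (d + 1)) R →+* MvPolynomial (Fin d) R[X] :=
  MvPolynomial.eval₂Hom (MvPolynomial.C.comp Polynomial.C)
    (Fin.cons (MvPolynomial.C X) MvPolynomial.X)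

theorem firstVariableToCoeff_injective (d : ℕ) (R : Type) [CommRing R] :
    Function.Injective (firstVariableToCoeff d R) := by
  let ψ : MvPolynomial (Fin d) R[X] →+* MvPolynomial (Fin (d + 1)) R :=
    MvPolynomial.eval₂Hom (eval₂RingHom MvPolynomial.C (MvPolynomial.X 0))
      fun i => MvPolynomial.X i.succ
  have : ψ.comp (firstVariableToCoeff d R) = RingHom.id _ := by
    refine MvPolynomial.ringHom_ext (fun c => ?_) (fun i => ?_)
    · simp [ψ, firstVariableToCoeff]
    · refine Fin.cases ?_ (fun i => ?_) i <;> simp [ψ, firstVariableToCoeff]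
  exact Function.LeftInverse.injective (g := ψ) fun p => RingHom.congr_fun this p

theorem eval₂_firstVariableToCoeff {d : ℕ} {R : Type} [CommRing R] (φ : R →+* ℝ) (y : ℝ)
    (v : Fin d → ℝ) (p : MvPolynomial (Fin (d + 1)) R) :
    (firstVariableToCoeff d R p).eval₂ (eval₂RingHom φ y) v = p.eval₂ φ (Fin.cons y v) := by
  have : (MvPolynomial.eval₂Hom (eval₂RingHom φ y) v).comp (firstVariableToCoeff d R) =
      MvPolynomial.eval₂Hom φ (Fin.cons y v) := by
    refine MvPolynomial.ringHom_ext (fun c => ?_) (fun i => ?_)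
    · simp [firstVariableToCoeff]
    · refine Fin.cases ?_ (fun i => ?_) i <;> simp [firstVariableToCoeff]
  exact RingHom.congr_fun this p

/-- The iterated limit of a rational function exists; as a function of parameters it is eventually
infinite of constant sign or a rational function. -/
theorem exists_hasIteratedLimit_div : ∀ (d : ℕ) {R Ω : Type} [CommRing R] [IsDomain R]
    {l : Filter Ω} {ev : Ω → R →+* ℝ}, HasEventualSigns l ev →
    ∀ (p q : MvPolynomial (Fin d) R), q ≠ 0 → ∃ g : Ω → EReal,
      (∀ᶠ ω in l, HasIteratedLimit d
        (fun v => ((p.eval₂ (ev ω) v / q.eval₂ (ev ω) v : ℝ) : EReal)) (g ω)) ∧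
      ((∀ ω, g ω = ⊤) ∨ (∀ ω, g ω = ⊥) ∨
        ∃ u w : R, w ≠ 0 ∧ ∀ ω, g ω = ((ev ω u / ev ω w : ℝ) : EReal))
  | 0, R, Ω, _, _, l, ev, _, p, q, hq => by
    have key : ∀ p : MvPolynomial (Fin 0) R, ∃ c, p = MvPolynomial.C c := fun p =>
      ⟨_, p.eq_C_of_isEmpty⟩
    obtain ⟨u, rfl⟩ := key p
    obtain ⟨w, rfl⟩ := key q
    refine ⟨fun ω => ((ev ω u / ev ω w : ℝ) : EReal), Eventually.of_forall fun ω => ?_,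
      Or.inr (Or.inr ⟨u, w, fun h => hq (by rw [h, map_zero]), fun _ => rfl⟩)⟩
    simp [HasIteratedLimit]
  | d + 1, R, Ω, _, _, l, ev, hl, p, q, hq => by
    -- The outermost variable joins the coefficient ring and the parameter space, so the induction
    -- hypothesis performs the inner limits with it as a parameter.
    obtain ⟨g, hg, hform⟩ := exists_hasIteratedLimit_div d hl.polynomial
      (firstVariableToCoeff d R p) (firstVariableToCoeff d R q)
      ((map_ne_zero_iff _ (firstVariableToCoeff_injective d R)).2 hq)
    simp only [eventually_curry_iff, eval₂_firstVariableToCoeff] at hg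
    have hpos : ∀ᶠ y in 𝓝[>] (0 : ℝ), 0 < y := self_mem_nhdsWithin
    suffices hG : ∃ G : Ω → EReal,
        (∀ᶠ ω in l, Tendsto (fun y => g (ω, y)) (𝓝[>] (0 : ℝ)) (𝓝 (G ω))) ∧
        ((∀ ω, G ω = ⊤) ∨ (∀ ω, G ω = ⊥) ∨
          ∃ u w : R, w ≠ 0 ∧ ∀ ω, G ω = ((ev ω u / ev ω w : ℝ) : EReal)) by
      obtain ⟨G, hG1, hG2⟩ := hG
      exact ⟨G, (hg.and hG1).mono fun ω hω => ⟨fun y => g (ω, y), hω.1, hω.2⟩, hG2⟩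
    rcases hform with h | h | ⟨u, w, hw, h⟩
    · exact ⟨fun _ => ⊤, by simp [h], Or.inl fun _ => rfl⟩
    · exact ⟨fun _ => ⊥, by simp [h], Or.inr (Or.inl fun _ => rfl)⟩
    · have hzero : ∀ c : R, ∃ u w : R, w ≠ 0 ∧
          ∀ ω, (0 : EReal) = ((ev ω u / ev ω w : ℝ) : EReal) := fun _ => ⟨0, 1, by simp, by simp⟩
      simp only [h, coe_eval₂RingHom]
      by_cases hu : u = 0
      · exact ⟨fun _ => 0, by simp [hu], Or.inr (Or.inr (hzero 0))⟩
      obtain ⟨a, u, rfl, hu0⟩ := exists_eq_X_pow_mul hu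
      obtain ⟨b, w, rfl, hw0⟩ := exists_eq_X_pow_mul hw
      simp only [eval₂_mul, eval₂_X_pow]
      have hw0' : ∀ᶠ ω in l, ev ω (w.coeff 0) ≠ 0 :=
        (hl _ hw0).elim (fun h => h.mono fun _ => ne_of_gt) fun h => h.mono fun _ => ne_of_lt
      have key := fun ω (hω : ev ω (w.coeff 0) ≠ 0) => tendsto_pow_mul_div_pow_mul
        (tendsto_eval₂_coeff_zero (ev ω) u) (tendsto_eval₂_coeff_zero (ev ω) w) hω a b
      rcases lt_trichotomy a b with hab | hab | hab
      -- The limit is infinite, with the sign of the product of the two constant terms; this sign is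
      -- eventually constant in `ω`, so the alternative in the conclusion does not depend on the
      -- parameter.
      · rcases hl _ (mul_ne_zero hu0 hw0) with hs | hs
        · refine ⟨fun _ => ⊤, ?_, Or.inl fun _ => rfl⟩
          filter_upwards [hw0', hs] with ω h1 h2
          exact (key ω h1).2.2.1 hab (by simpa using h2)
        · refine ⟨fun _ => ⊥, ?_, Or.inr (Or.inl fun _ => rfl)⟩
          filter_upwards [hw0', hs] with ω h1 h2
          exact (key ω h1).2.2.2 hab (by simpa using h2)
      · exact ⟨_, hw0'.mono fun ω h1 => (key ω h1).2.1 hab,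
          Or.inr (Or.inr ⟨_, _, hw0, fun _ => rfl⟩)⟩
      · exact ⟨_, hw0'.mono fun ω h1 => (key ω h1).1 hab, Or.inr (Or.inr (hzero 0))⟩

theorem exists_hasIteratedLimit_aeval_div {d : ℕ} (p q : MvPolynomial (Fin d) ℤ) (hq : q ≠ 0) :
    ∃ L, HasIteratedLimit d
      (fun v => ((MvPolynomial.aeval v p / MvPolynomial.aeval v q : ℝ) : EReal)) L := by
  have hs : HasEventualSigns (pure () : Filter Unit) fun _ => Int.castRingHom ℝ := by
    intro c hc
    simpa using hc.symm.lt_or_gt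
  obtain ⟨g, hg, -⟩ := exists_hasIteratedLimit_div d hs p q hq
  exact ⟨g (), eventually_pure.1 hg⟩

end RationalLimit

/-! ### Degree and coefficient bounds for integer polynomials and determinants. -/

section IntegerPolynomials

variable {σ : Type*}

/-- The sum of the absolute values of the coefficients. -/
def coeffNorm (p : MvPolynomial σ ℤ) : ℕ := ∑ a ∈ p.support, (p.coeff a).natAbs

theorem coeffNorm_eq_sum {p : MvPolynomial σ ℤ} {s : Finset (σ →₀ ℕ)} (hs : p.support ⊆ s) :
    coeffNorm p = ∑ a ∈ s, (p.coeff a).natAbs :=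
  Finset.sum_subset hs fun a _ ha => by simpa using ha

theorem coeffNorm_add_le (p q : MvPolynomial σ ℤ) :
    coeffNorm (p + q) ≤ coeffNorm p + coeffNorm q := by
  classical
  rw [coeffNorm_eq_sum (MvPolynomial.support_add (p := p) (q := q)),
    coeffNorm_eq_sum (Finset.subset_union_left (s₁ := p.support) (s₂ := q.support)),
    coeffNorm_eq_sum (Finset.subset_union_right (s₁ := p.support) (s₂ := q.support)),
    ← Finset.sum_add_distrib]
  exact Finset.sum_le_sum fun a _ => by rw [MvPolynomial.coeff_add]; exact Int.natAbs_add_le _ _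

@[simp] theorem coeffNorm_neg (p : MvPolynomial σ ℤ) : coeffNorm (-p) = coeffNorm p := by
  simp [coeffNorm]

@[simp] theorem coeffNorm_monomial (a : σ →₀ ℕ) (c : ℤ) :
    coeffNorm (MvPolynomial.monomial a c) = c.natAbs := by
  classical
  rw [coeffNorm_eq_sum MvPolynomial.support_monomial_subset]
  simp

theorem coeffNorm_sum_le {ι : Type*} (s : Finset ι) (f : ι → MvPolynomial σ ℤ) :
    coeffNorm (∑ i ∈ s, f i) ≤ ∑ i ∈ s, coeffNorm (f i) := by
  classical
  induction s using Finset.induction_on with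
  | empty => simp [coeffNorm]
  | insert i s hi ih =>
    rw [Finset.sum_insert hi, Finset.sum_insert hi]
    exact (coeffNorm_add_le _ _).trans (by omega)

theorem coeffNorm_mul_le (p q : MvPolynomial σ ℤ) :
    coeffNorm (p * q) ≤ coeffNorm p * coeffNorm q := by
  have h : p * q = ∑ a ∈ p.support, ∑ b ∈ q.support,
      MvPolynomial.monomial (a + b) (p.coeff a * q.coeff b) := by
    conv_lhs => rw [p.as_sum, q.as_sum]
    simp only [Finset.sum_mul_sum, MvPolynomial.monomial_mul]
  rw [h]
  refine (coeffNorm_sum_le _ _).trans ?_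
  rw [coeffNorm, coeffNorm, Finset.sum_mul_sum]
  refine Finset.sum_le_sum fun a _ => (coeffNorm_sum_le _ _).trans (le_of_eq ?_)
  simp [Int.natAbs_mul]

/-- `p` has degree at most `m` in every variable, and coefficients of absolute sum at most `E`. -/
def PolyBound (p : MvPolynomial σ ℤ) (m E : ℕ) : Prop :=
  (∀ i, p.degreeOf i ≤ m) ∧ coeffNorm p ≤ E

theorem PolyBound.mono {p : MvPolynomial σ ℤ} {m m' E E' : ℕ} (h : PolyBound p m E)
    (hm : m ≤ m') (hE : E ≤ E') : PolyBound p m' E' :=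
  ⟨fun i => (h.1 i).trans hm, h.2.trans hE⟩

theorem PolyBound.add {p q : MvPolynomial σ ℤ} {m E F : ℕ} (hp : PolyBound p m E)
    (hq : PolyBound q m F) : PolyBound (p + q) m (E + F) :=
  ⟨fun i => (MvPolynomial.degreeOf_add_le i p q).trans (max_le (hp.1 i) (hq.1 i)),
    (coeffNorm_add_le p q).trans (add_le_add hp.2 hq.2)⟩

theorem PolyBound.neg {p : MvPolynomial σ ℤ} {m E : ℕ} (hp : PolyBound p m E) :
    PolyBound (-p) m E :=
  ⟨fun i => by rw [MvPolynomial.degreeOf_neg]; exact hp.1 i, by rw [coeffNorm_neg]; exact hp.2⟩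

theorem PolyBound.sub {p q : MvPolynomial σ ℤ} {m E F : ℕ} (hp : PolyBound p m E)
    (hq : PolyBound q m F) : PolyBound (p - q) m (E + F) := by
  rw [sub_eq_add_neg]; exact hp.add hq.neg

theorem PolyBound.mul {p q : MvPolynomial σ ℤ} {m n E F : ℕ} (hp : PolyBound p m E)
    (hq : PolyBound q n F) : PolyBound (p * q) (m + n) (E * F) :=
  ⟨fun i => (MvPolynomial.degreeOf_mul_le i p q).trans (add_le_add (hp.1 i) (hq.1 i)),
    (coeffNorm_mul_le p q).trans (Nat.mul_le_mul hp.2 hq.2)⟩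

theorem PolyBound.C (c : ℤ) : PolyBound (MvPolynomial.C c : MvPolynomial σ ℤ) 0 c.natAbs :=
  ⟨fun i => by rw [MvPolynomial.degreeOf_C], by rw [MvPolynomial.C_apply, coeffNorm_monomial]⟩

theorem PolyBound.X (i : σ) : PolyBound (MvPolynomial.X i : MvPolynomial σ ℤ) 1 1 := by
  classical
  exact ⟨fun j => by rw [MvPolynomial.degreeOf_X]; split_ifs <;> simp,
    by rw [MvPolynomial.X, coeffNorm_monomial]; simp⟩

theorem PolyBound.zero (m E : ℕ) : PolyBound (0 : MvPolynomial σ ℤ) m E :=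
  ⟨fun i => by simp, by simp [coeffNorm]⟩

theorem PolyBound.one : PolyBound (1 : MvPolynomial σ ℤ) 0 1 := by
  simpa using PolyBound.C (σ := σ) 1

theorem PolyBound.prod {ι : Type*} (s : Finset ι) {f : ι → MvPolynomial σ ℤ} {m E : ι → ℕ}
    (h : ∀ i ∈ s, PolyBound (f i) (m i) (E i)) :
    PolyBound (∏ i ∈ s, f i) (∑ i ∈ s, m i) (∏ i ∈ s, E i) := by
  classical
  induction s using Finset.induction_on with
  | empty => simpa using PolyBound.one
  | insert i s hi ih =>
    rw [Finset.prod_insert hi, Finset.sum_insert hi, Finset.prod_insert hi]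
    exact (h i (Finset.mem_insert_self i s)).mul
      (ih fun j hj => h j (Finset.mem_insert_of_mem hj))

theorem PolyBound.sum {ι : Type*} (s : Finset ι) {f : ι → MvPolynomial σ ℤ} {m E : ℕ}
    (h : ∀ i ∈ s, PolyBound (f i) m E) : PolyBound (∑ i ∈ s, f i) m (s.card * E) := by
  classical
  induction s using Finset.induction_on with
  | empty => simpa using PolyBound.zero m 0
  | insert i s hi ih =>
    rw [Finset.sum_insert hi, Finset.card_insert_of_notMem hi, add_mul, one_mul, add_comm _ E]
    exact (h i (Finset.mem_insert_self i s)).add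
      (ih fun j hj => h j (Finset.mem_insert_of_mem hj))

theorem PolyBound.det {k : Type*} [Fintype k] [DecidableEq k]
    {M : Matrix k k (MvPolynomial σ ℤ)} {m E : k → ℕ}
    (h : ∀ i j, PolyBound (M i j) (m i) (E i)) :
    PolyBound M.det (∑ i, m i) ((Fintype.card k).factorial * ∏ i, E i) := by
  rw [Matrix.det_apply']
  rw [← Fintype.card_perm, ← Finset.card_univ]
  refine PolyBound.sum _ fun τ _ => ?_
  have hp : PolyBound (∏ i, M (τ i) i) (∑ i, m i) (∏ i, E i) := by
    rw [← Equiv.sum_comp τ m, ← Equiv.prod_comp τ E]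
    exact PolyBound.prod _ fun i _ => h _ _
  rcases Int.units_eq_one_or (Equiv.Perm.sign τ) with hs | hs
  · simpa [hs] using hp
  · simpa [hs] using hp.neg

/-- The border row has degree 0 and entries of norm at most 1, so the border affects only the
factorial. -/
theorem PolyBound.det_borderedMatrix {k : Type*} [Fintype k] [DecidableEq k]
    {K : Matrix k k (MvPolynomial σ ℤ)} {m E : ℕ} (hE : 1 ≤ E)
    (h : ∀ i j, PolyBound (K i j) m E) :
    PolyBound (borderedMatrix K).det (Fintype.card k * m)
      ((Fintype.card k + 1).factorial * E ^ Fintype.card k) := by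
  have := PolyBound.det (M := borderedMatrix K) (m := Sum.elim (fun _ => m) fun _ => 0)
    (E := Sum.elim (fun _ => E) fun _ => 1) (by
      rintro (i | i) (j | j)
      · exact h i j
      · exact PolyBound.one.mono (Nat.zero_le _) hE
      · exact PolyBound.one.neg
      · exact PolyBound.zero _ _)
  simpa using this

end IntegerPolynomials

theorem borderedMatrix_map {m R R' : Type*} [CommRing R] [CommRing R'] (φ : R →+* R')
    (K : Matrix m m R) : (borderedMatrix K).map φ = borderedMatrix (K.map φ) := by
  rw [borderedMatrix, borderedMatrix, Matrix.fromBlocks_map]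
  congr 1
  · ext; simp
  · ext; simp
  · ext; simp

/-! ### The region of rapidly decreasing discount factors. -/

section Region

/-- The points with positive coordinates, each of which is much smaller than the preceding ones. -/
def lexRegion (d : ℕ) (ε : ℝ) (m : ℕ) : Set (Fin d → ℝ) :=
  {v | ∀ i, 0 < v i ∧ v i ≤ ε * ∏ j, if j < i then v j ^ m else 1}

variable {d : ℕ} {ε : ℝ} {m : ℕ} {v : Fin d → ℝ}

theorem cons_mem_lexRegion {x : ℝ} (hx : 0 < x) (hxε : x ≤ ε) (hv : v ∈ lexRegion d (ε * x ^ m) m) :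
    (Fin.cons x v : Fin (d + 1) → ℝ) ∈ lexRegion (d + 1) ε m := by
  intro i
  refine Fin.cases ?_ (fun i => ?_) i
  · simpa using ⟨hx, hxε⟩
  · have := hv i
    simpa [Fin.prod_univ_succ, mul_assoc] using this

theorem iteratedEventually_mem_lexRegion (m : ℕ) : ∀ (d : ℕ) {ε : ℝ}, 0 < ε →
    IteratedEventually d fun v => v ∈ lexRegion d ε m
  | 0, _, _ => fun i => i.elim0
  | d + 1, ε, hε => by
    have h1 : ∀ᶠ x in 𝓝[>] (0 : ℝ), x < ε := nhdsWithin_le_nhds (gt_mem_nhds hε)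
    have h2 : ∀ᶠ x in 𝓝[>] (0 : ℝ), 0 < x := self_mem_nhdsWithin
    change ∀ᶠ x in 𝓝[>] (0 : ℝ), IteratedEventually d _
    filter_upwards [h1, h2] with x hx1 hx2
    exact (iteratedEventually_mem_lexRegion m d (ε := ε * x ^ m) (by positivity)).mono
      fun v hv => cons_mem_lexRegion hx2 hx1.le hv

theorem lexRegion_le_one (hε : ε ≤ 1) (hv : v ∈ lexRegion d ε m) (i : Fin d) : v i ≤ 1 := by
  induction i using WellFoundedLT.induction with
  | ind i ih =>
    have hprod : ∏ j, (if j < i then v j ^ m else 1) ≤ 1 := by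
      refine Finset.prod_le_one (fun j _ => ?_) fun j _ => ?_
      · split_ifs
        · exact (pow_pos (hv j).1 m).le
        · exact zero_le_one
      · split_ifs with h
        · exact pow_le_one₀ (hv j).1.le (ih j h)
        · exact le_rfl
    have hnn : 0 ≤ ∏ j, (if j < i then v j ^ m else 1) :=
      Finset.prod_nonneg fun j _ => by
        split_ifs
        · exact (pow_pos (hv j).1 m).le
        · exact zero_le_one
    exact (hv i).2.trans ((mul_le_mul_of_nonneg_right hε hnn).trans (by simpa using hprod))

/-- In the coordinates log `v i` the defining inequalities are linear, so the region is the
continuous image of a convex set. -/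
theorem isPreconnected_lexRegion (hε : 0 < ε) : IsPreconnected (lexRegion d ε m) := by
  let Y : Set (Fin d → ℝ) := {y | ∀ i, y i ≤ Real.log ε + ∑ j, if j < i then (m : ℝ) * y j else 0}
  have hexp : ∀ (y : Fin d → ℝ) (i : Fin d),
      Real.exp (Real.log ε + ∑ j, if j < i then (m : ℝ) * y j else 0) =
      ε * ∏ j, if j < i then Real.exp (y j) ^ m else 1 := by
    intro y i
    rw [Real.exp_add, Real.exp_log hε, Real.exp_sum]
    congr 1
    refine Finset.prod_congr rfl fun j _ => ?_
    split_ifs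
    · rw [Real.exp_nat_mul]
    · exact Real.exp_zero
  have hY : Convex ℝ Y := by
    have : Y = ⋂ i, {y | y i - ∑ j, (if j < i then (m : ℝ) * y j else 0) ≤ Real.log ε} := by
      ext y
      simp only [Y, Set.mem_iInter, Set.mem_ofPred_eq, sub_le_iff_le_add]
    rw [this]
    refine convex_iInter fun i => convex_halfSpace_le (f := fun y : Fin d → ℝ =>
      y i - ∑ j, (if j < i then (m : ℝ) * y j else 0)) ⟨fun y z => ?_, fun c y => ?_⟩ _
    · simp only [Pi.add_apply, mul_add]
      rw [← add_sub_add_comm, ← Finset.sum_add_distrib]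
      refine congrArg _ (Finset.sum_congr rfl fun j _ => ?_)
      split_ifs <;> simp
    · simp only [Pi.smul_apply, smul_eq_mul, mul_sub, Finset.mul_sum]
      refine congrArg _ (Finset.sum_congr rfl fun j _ => ?_)
      split_ifs
      · ring
      · simp
  have himage : lexRegion d ε m = (fun (y : Fin d → ℝ) i => Real.exp (y i)) '' Y := by
    ext v
    constructor
    · intro hv
      refine ⟨fun i => Real.log (v i), fun i => ?_, ?_⟩
      · rw [← Real.exp_le_exp, hexp]
        simpa only [Real.exp_log (hv _).1] using (hv i).2
      · ext i
        exact Real.exp_log (hv i).1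
    · rintro ⟨y, hy, rfl⟩ i
      refine ⟨Real.exp_pos _, ?_⟩
      rw [← hexp]
      exact Real.exp_le_exp.2 (hy i)
  rw [himage]
  exact hY.isPreconnected.image _ (by fun_prop)

/-- The last variable in which the exponents differ decides: one extra factor `v i` compensates any
loss in the earlier variables, which is at most `∏_{j<i} v_j^{-m}`, and still leaves the factor `ε`.
-/
theorem monomial_le_of_lt (hε : ε ≤ 1) (hv : v ∈ lexRegion d ε m) {a b : Fin d → ℕ}
    (ha : ∀ i, a i ≤ m) {i : Fin d} (hi : a i < b i) (hj : ∀ j, i < j → a j = b j) :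
    ∏ j, v j ^ b j ≤ ε * ∏ j, v j ^ a j := by
  have hP : 0 < ∏ j, if j < i then v j ^ m else 1 :=
    Finset.prod_pos fun j _ => by
      split_ifs
      · exact pow_pos (hv j).1 m
      · exact one_pos
  have h1 : ∏ j, v j ^ b j ≤ ∏ j, v j ^ a j *
      ((if j = i then v j else 1) * (if j < i then v j ^ m else 1)⁻¹) := by
    refine Finset.prod_le_prod (fun j _ => (pow_pos (hv j).1 _).le) fun j _ => ?_
    have hvj := (hv j).1
    have hvj1 := lexRegion_le_one hε hv j
    rcases lt_trichotomy j i with h | h | h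
    · simp only [h, h.ne, if_true, if_false, one_mul]
      rw [le_mul_inv_iff₀ (pow_pos hvj _)]
      calc v j ^ b j * v j ^ m ≤ 1 * v j ^ m :=
            mul_le_mul_of_nonneg_right (pow_le_one₀ hvj.le hvj1) (pow_pos hvj _).le
        _ ≤ v j ^ a j := by
            rw [one_mul]; exact pow_le_pow_of_le_one hvj.le hvj1 (ha j)
    · subst h
      simp only [lt_irrefl, if_true, if_false, inv_one, mul_one]
      rw [← pow_succ]
      exact pow_le_pow_of_le_one hvj.le hvj1 hi
    · simp [h.ne', h.not_gt, hj j h]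
  refine h1.trans ?_
  rw [Finset.prod_mul_distrib, mul_comm ε, Finset.prod_mul_distrib, Finset.prod_inv_distrib]
  refine mul_le_mul_of_nonneg_left ?_ (Finset.prod_nonneg fun j _ => (pow_pos (hv j).1 _).le)
  rw [mul_inv_le_iff₀ hP, Finset.prod_ite_eq' Finset.univ i v]
  simpa using (hv i).2

theorem monomial_le_or_le (hε : ε ≤ 1) (hv : v ∈ lexRegion d ε m) {a b : Fin d → ℕ}
    (ha : ∀ i, a i ≤ m) (hb : ∀ i, b i ≤ m) (hab : a ≠ b) :
    ∏ j, v j ^ b j ≤ ε * ∏ j, v j ^ a j ∨ ∏ j, v j ^ a j ≤ ε * ∏ j, v j ^ b j := by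
  have hne : (Finset.univ.filter fun i => a i ≠ b i).Nonempty := by
    obtain ⟨i, hi⟩ := Function.ne_iff.1 hab
    exact ⟨i, by simpa using hi⟩
  set i := Finset.max' _ hne with hidef
  have hi : a i ≠ b i := by simpa using Finset.max'_mem _ hne
  have hj : ∀ j, i < j → a j = b j := by
    intro j hij
    by_contra h
    exact absurd (Finset.le_max' _ j (by simpa using h)) (not_le.2 hij)
  rcases hi.lt_or_gt with h | h
  · exact Or.inl (monomial_le_of_lt hε hv ha h hj)
  · exact Or.inr (monomial_le_of_lt hε hv hb h fun j hij => (hj j hij).symm)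

theorem aeval_ne_zero_of_mem_lexRegion {p : MvPolynomial (Fin d) ℤ} {E : ℕ} (hp : p ≠ 0)
    (hb : PolyBound p m E) (hε : 0 ≤ ε) (hE : ε * E < 1) (hv : v ∈ lexRegion d ε m) :
    MvPolynomial.aeval v p ≠ 0 := by
  have hsupp : p.support.Nonempty := MvPolynomial.support_nonempty.2 hp
  let μ : (Fin d →₀ ℕ) → ℝ := fun a => ∏ j, v j ^ a j
  have hμ : ∀ a, 0 < μ a := fun a => Finset.prod_pos fun j _ => pow_pos (hv j).1 _
  -- The dominant monomial at `v`. Its coefficient is a nonzero integer, hence at least 1 in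
  -- absolute value, while the other terms together contribute at most `ε * E` times this monomial.
  obtain ⟨a, ha, hmax⟩ := p.support.exists_max_image μ hsupp
  have hcoeff : 1 ≤ (p.coeff a).natAbs := Nat.one_le_iff_ne_zero.2 <| by
    simpa using ha
  have hnorm : (p.coeff a).natAbs + ∑ b ∈ p.support.erase a, (p.coeff b).natAbs ≤ E := by
    rw [Finset.add_sum_erase _ (fun b => (p.coeff b).natAbs) ha]; exact hb.2
  have hE1 : (1 : ℝ) ≤ E := by exact_mod_cast (by omega : 1 ≤ E)
  have hε1 : ε < 1 := lt_of_le_of_lt (le_mul_of_one_le_right hε hE1) hE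
  have hdeg : ∀ b ∈ p.support, ∀ i, b i ≤ m := fun b hb' i =>
    (MvPolynomial.le_degreeOf_of_mem_support i hb').trans (hb.1 i)
  have hsmall : ∀ b ∈ p.support.erase a, μ b ≤ ε * μ a := by
    intro b hb'
    obtain ⟨hba, hbs⟩ := Finset.mem_erase.1 hb'
    rcases monomial_le_or_le hε1.le hv (hdeg a ha) (hdeg b hbs)
      (fun h => hba (DFunLike.coe_injective h).symm) with h | h
    · exact h
    · have h1 : μ a ≤ ε * μ b := h
      have h2 := hmax b hbs
      have h3 : ε * μ b < 1 * μ b := mul_lt_mul_of_pos_right hε1 (hμ b)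
      linarith
  have habs : ∀ c : ℤ, |(c : ℝ)| = c.natAbs := fun c => by
    rw [Nat.cast_natAbs, Int.cast_abs]
  rw [MvPolynomial.aeval_def, MvPolynomial.eval₂_eq', ← Finset.add_sum_erase _ _ ha]
  have h1 : |∑ b ∈ p.support.erase a, (algebraMap ℤ ℝ) (p.coeff b) * ∏ i, v i ^ b i| ≤
      (ε * ∑ b ∈ p.support.erase a, ((p.coeff b).natAbs : ℝ)) * μ a := by
    refine (Finset.abs_sum_le_sum_abs _ _).trans ?_
    rw [mul_right_comm, Finset.mul_sum]
    refine Finset.sum_le_sum fun b hb' => ?_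
    rw [abs_mul, eq_intCast, habs, abs_of_pos (hμ b), mul_comm]
    exact mul_le_mul_of_nonneg_right (hsmall b hb') (Nat.cast_nonneg _)
  have h2 : ε * ∑ b ∈ p.support.erase a, ((p.coeff b).natAbs : ℝ) < 1 := by
    refine lt_of_le_of_lt (mul_le_mul_of_nonneg_left ?_ hε) hE
    exact_mod_cast (by omega : ∑ b ∈ p.support.erase a, (p.coeff b).natAbs ≤ E)
  have h3 : μ a ≤ |(algebraMap ℤ ℝ) (p.coeff a) * ∏ i, v i ^ a i| := by
    rw [abs_mul, eq_intCast, habs, abs_of_pos (hμ a)]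
    exact le_mul_of_one_le_left (hμ a).le (by exact_mod_cast hcoeff)
  intro h0
  rw [add_eq_zero_iff_eq_neg] at h0
  rw [h0, abs_neg] at h3
  have := mul_lt_mul_of_pos_right h2 (hμ a)
  linarith

end Region

/-! ### A zero of a function covered by finitely many others propagates. -/

section Connectedness

/-- The set where `g` is nonzero is the finite union of the closed sets `g = f i` over the nowhere
vanishing `f i`. The zero set of `g` is therefore both closed and open. -/
theorem eq_zero_on_of_isPreconnected {α ι : Type*} [TopologicalSpace α] [Finite ι] {C : Set α}
    (hC : IsPreconnected C) {g : α → ℝ} (hg : ContinuousOn g C) {f : ι → α → ℝ}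
    (hf : ∀ i, ContinuousOn (f i) C) (hcov : ∀ c ∈ C, ∃ i, g c = f i c)
    (hdich : ∀ i, (∀ c ∈ C, f i c = 0) ∨ ∀ c ∈ C, f i c ≠ 0)
    {c₀ : α} (hc₀ : c₀ ∈ C) (h0 : g c₀ = 0) : ∀ c ∈ C, g c = 0 := by
  rw [isPreconnected_iff_preconnectedSpace] at hC
  have hgc : Continuous fun c : C => g c := continuousOn_iff_continuous_domRestrict.1 hg
  have hfc : ∀ i, Continuous fun c : C => f i c := fun i =>
    continuousOn_iff_continuous_domRestrict.1 (hf i)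
  let N : Set C := ⋃ i ∈ {i | ∀ c ∈ C, f i c ≠ 0}, {c | g c = f i c}
  have hN : IsClosed N :=
    (Set.toFinite _).isClosed_biUnion fun i _ => isClosed_eq hgc (hfc i)
  have hZ : IsClosed {c : C | g c = 0} := isClosed_eq hgc continuous_const
  have hcompl : {c : C | g c = 0} = Nᶜ := by
    ext c
    simp only [N, Set.mem_ofPred_eq, Set.mem_compl_iff, Set.mem_iUnion, not_exists]
    constructor
    · intro h i hi hgi
      exact hi c c.2 (hgi.symm.trans h)
    · intro h
      obtain ⟨i, hi⟩ := hcov c c.2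
      rcases hdich i with h1 | h1
      · rw [hi, h1 c c.2]
      · exact absurd hi (h i h1)
  have hclopen : IsClopen {c : C | g c = 0} :=
    ⟨hZ, by rw [hcompl]; exact hN.isOpen_compl⟩
  have huniv := hclopen.eq_univ ⟨⟨c₀, hc₀⟩, h0⟩
  intro c hc
  have : (⟨c, hc⟩ : C) ∈ {c : C | g c = 0} := by rw [huniv]; trivial
  exact this

end Connectedness

theorem IteratedEventually.exists : ∀ {d : ℕ} {p : (Fin d → ℝ) → Prop},
    IteratedEventually d p → ∃ v, p v
  | 0, _, h => ⟨_, h⟩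
  | _ + 1, _, h =>
    have ⟨x, hx⟩ := Eventually.exists h
    have ⟨v, hv⟩ := hx.exists
    ⟨Fin.cons x v, hv⟩

theorem exists_polyBound {σ ι : Type*} [Finite σ] [Finite ι] (p : ι → MvPolynomial σ ℤ) :
    ∃ m E, ∀ k, PolyBound (p k) m E := by
  obtain ⟨m, hm⟩ := Finite.exists_le fun k : ι × σ => (p k.1).degreeOf k.2
  obtain ⟨E, hE⟩ := Finite.exists_le fun k => coeffNorm (p k)
  exact ⟨m, E, fun k => ⟨fun i => hm (k, i), hE k⟩⟩

/-! ### Matrix games with polynomial entries. -/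

section PolynomialGame

variable {I J : Type*} {d : ℕ}

/-- The matrix of real numbers obtained by evaluating a matrix of integer polynomials. -/
def evalMatrix (W : Matrix I J (MvPolynomial (Fin d) ℤ)) (v : Fin d → ℝ) : Matrix I J ℝ :=
  W.map (MvPolynomial.aeval v)

theorem det_evalMatrix [Fintype I] [DecidableEq I] (W : Matrix I I (MvPolynomial (Fin d) ℤ))
    (v : Fin d → ℝ) : (evalMatrix W v).det = MvPolynomial.aeval v W.det :=
  (AlgHom.map_det _ W).symm

theorem continuous_aeval (p : MvPolynomial (Fin d) ℤ) :
    Continuous fun v : Fin d → ℝ => MvPolynomial.aeval v p := by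
  simp only [MvPolynomial.aeval_def, MvPolynomial.eval₂_eq']
  fun_prop

theorem continuous_value_evalMatrix [Fintype I] [Nonempty I] [Fintype J] [Nonempty J]
    (W : Matrix I J (MvPolynomial (Fin d) ℤ)) :
    Continuous fun v => matrixGameValue (evalMatrix W v) :=
  continuous_matrixGameValue.comp <| continuous_matrix fun i j => continuous_aeval (W i j)

variable [DecidableEq I]

/-- The numerator in the value formula of Shapley and Snow for a kernel. -/
def kernelNum (W : Matrix I J (MvPolynomial (Fin d) ℤ)) (k : Σ X : Finset I, (X → J)) :
    MvPolynomial (Fin d) ℤ := (W.submatrix Subtype.val k.2).det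

/-- The denominator in the value formula of Shapley and Snow for a kernel. -/
def kernelDen (W : Matrix I J (MvPolynomial (Fin d) ℤ)) (k : Σ X : Finset I, (X → J)) :
    MvPolynomial (Fin d) ℤ := (borderedMatrix (W.submatrix Subtype.val k.2)).det

variable [Fintype I] [Nonempty I] [Fintype J] [Nonempty J]

theorem exists_kernel_evalMatrix (W : Matrix I J (MvPolynomial (Fin d) ℤ)) (v : Fin d → ℝ) :
    ∃ k : {k : Σ X : Finset I, (X → J) // kernelDen W k ≠ 0},
      matrixGameValue (evalMatrix W v) =
        MvPolynomial.aeval v (kernelNum W k) / MvPolynomial.aeval v (kernelDen W k) := by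
  obtain ⟨X, e, h0, hval⟩ := exists_kernel_matrixGameValue (evalMatrix W v)
  have h1 : ((evalMatrix W v).submatrix Subtype.val e).det =
      MvPolynomial.aeval v (kernelNum W ⟨X, e⟩) :=
    det_evalMatrix (W.submatrix Subtype.val e) v
  have h2 : (borderedMatrix ((evalMatrix W v).submatrix Subtype.val e)).det =
      MvPolynomial.aeval v (kernelDen W ⟨X, e⟩) := by
    rw [kernelDen, ← det_evalMatrix, evalMatrix, evalMatrix]
    exact congrArg Matrix.det (borderedMatrix_map
      ((MvPolynomial.aeval v : MvPolynomial (Fin d) ℤ →ₐ[ℤ] ℝ) : MvPolynomial (Fin d) ℤ →+* ℝ)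
      (W.submatrix Subtype.val e)).symm
  rw [h1, h2] at hval
  rw [h2] at h0
  exact ⟨⟨⟨X, e⟩, fun h => h0 (by rw [h, map_zero])⟩, hval⟩

/-- Where no kernel polynomial vanishes, the value of the game has a constant sign. -/
theorem sign_value_evalMatrix {W : Matrix I J (MvPolynomial (Fin d) ℤ)} {n E D : ℕ} {ε : ℝ}
    (hW : ∀ i j, PolyBound (W i j) n E) (hE : 1 ≤ E) (hD : Fintype.card I ≤ D) (hε : 0 < ε)
    (hεE : ε * ((D + 1).factorial * E ^ D : ℕ) < 1) {v₀ : Fin d → ℝ}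
    (hv₀ : v₀ ∈ lexRegion d ε (n * D)) {v : Fin d → ℝ} (hv : v ∈ lexRegion d ε (n * D)) :
    (matrixGameValue (evalMatrix W v₀) = 0 → matrixGameValue (evalMatrix W v) = 0) ∧
    (0 < matrixGameValue (evalMatrix W v₀) → 0 < matrixGameValue (evalMatrix W v)) ∧
    (matrixGameValue (evalMatrix W v₀) < 0 → matrixGameValue (evalMatrix W v) < 0) := by
  have hcard : ∀ X : Finset I, Fintype.card X ≤ D := fun X => by
    rw [Fintype.card_coe]; exact (Finset.card_le_univ X).trans hD
  have hbound : ∀ {p : MvPolynomial (Fin d) ℤ} {c : ℕ}, c ≤ D →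
      PolyBound p (c * n) ((c + 1).factorial * E ^ c) →
      PolyBound p (n * D) ((D + 1).factorial * E ^ D) := fun hc h =>
    h.mono (by rw [mul_comm]; exact Nat.mul_le_mul_left n hc)
      (Nat.mul_le_mul (Nat.factorial_le (by omega)) (Nat.pow_le_pow_right hE hc))
  have hnum : ∀ k : Σ X : Finset I, (X → J),
      PolyBound (kernelNum W k) (n * D) ((D + 1).factorial * E ^ D) := fun k => by
    refine hbound (hcard k.1) ?_
    have := PolyBound.det (M := W.submatrix Subtype.val k.2) (m := fun _ => n) (E := fun _ => E)
      fun i j => hW _ _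
    rw [Finset.sum_const, Finset.prod_const, Finset.card_univ, smul_eq_mul] at this
    exact this.mono le_rfl (Nat.mul_le_mul_right _ (Nat.factorial_le (by omega)))
  have hden : ∀ k : Σ X : Finset I, (X → J),
      PolyBound (kernelDen W k) (n * D) ((D + 1).factorial * E ^ D) := fun k =>
    hbound (hcard k.1) (PolyBound.det_borderedMatrix hE fun i j => hW _ _)
  have hpre := isPreconnected_lexRegion (d := d) (m := n * D) hε
  have hcont := (continuous_value_evalMatrix W).continuousOn (s := lexRegion d ε (n * D))
  have hzero : ∀ v₀ ∈ lexRegion d ε (n * D), matrixGameValue (evalMatrix W v₀) = 0 →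
      ∀ v ∈ lexRegion d ε (n * D), matrixGameValue (evalMatrix W v) = 0 := by
    intro v₀ hv₀ h0
    have hden0 : ∀ k : {k : Σ X : Finset I, (X → J) // kernelDen W k ≠ 0},
        ∀ v ∈ lexRegion d ε (n * D), MvPolynomial.aeval v (kernelDen W k) ≠ 0 := fun k v hv =>
      aeval_ne_zero_of_mem_lexRegion k.2 (hden k) hε.le hεE hv
    refine eq_zero_on_of_isPreconnected hpre hcont
      (f := fun (k : {k : Σ X : Finset I, (X → J) // kernelDen W k ≠ 0}) v =>
        MvPolynomial.aeval v (kernelNum W k) / MvPolynomial.aeval v (kernelDen W k))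
      (fun k => (continuous_aeval _).continuousOn.div (continuous_aeval _).continuousOn (hden0 k))
      (fun v _ => exists_kernel_evalMatrix W v) (fun k => ?_) hv₀ h0
    by_cases hk : kernelNum W k = 0
    · exact Or.inl fun v _ => by rw [hk, map_zero, zero_div]
    · exact Or.inr fun v hv => div_ne_zero
        (aeval_ne_zero_of_mem_lexRegion hk (hnum k) hε.le hεE hv) (hden0 k v hv)
  -- By the intermediate value theorem, a change of sign would produce a zero in the region, and a
  -- zero spreads to `v₀`.
  refine ⟨fun h => hzero v₀ hv₀ h v hv, fun h => ?_, fun h => ?_⟩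
  · by_contra! hle
    obtain ⟨u, hu, hu0⟩ := hpre.intermediate_value hv hv₀ hcont ⟨hle, h.le⟩
    exact h.ne' (hzero u hu hu0 v₀ hv₀)
  · by_contra! hle
    obtain ⟨u, hu, hu0⟩ := hpre.intermediate_value hv₀ hv hcont ⟨h.le, hle⟩
    exact h.ne (hzero u hu hu0 v₀ hv₀)

/-- Iteratively eventually, the value of the game is given by a single kernel. -/
theorem iteratedEventually_value_eq_div (W : Matrix I J (MvPolynomial (Fin d) ℤ)) :
    ∃ p q : MvPolynomial (Fin d) ℤ, q ≠ 0 ∧ IteratedEventually d fun v =>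
      matrixGameValue (evalMatrix W v) = MvPolynomial.aeval v p / MvPolynomial.aeval v q := by
  let ι := {k : Σ X : Finset I, (X → J) // kernelDen W k ≠ 0}
  -- Common bounds for the kernel denominators (`none`) and for the numerators of differences of two
  -- kernel quotients (`some l`), so that all these quotients are defined and any two of them agree
  -- everywhere or nowhere on the region.
  obtain ⟨m, E, hb⟩ := exists_polyBound fun kl : ι × Option ι =>
    kl.2.elim (kernelDen W kl.1) fun l =>
      kernelNum W kl.1 * kernelDen W l - kernelNum W l * kernelDen W kl.1
  set ε : ℝ := 1 / (E + 1) with hεdef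
  have hε : 0 < ε := by positivity
  have hεE : ε * E < 1 := by
    rw [hεdef, div_mul_eq_mul_div, one_mul, div_lt_one (by positivity)]
    linarith
  have hR := iteratedEventually_mem_lexRegion m d hε
  obtain ⟨v₀, hv₀⟩ := hR.exists
  obtain ⟨l, hl⟩ := exists_kernel_evalMatrix W v₀
  have hden0 : ∀ k : ι, ∀ v ∈ lexRegion d ε m, MvPolynomial.aeval v (kernelDen W k) ≠ 0 :=
    fun k v hv => aeval_ne_zero_of_mem_lexRegion k.2 (hb (k, none)) hε.le hεE hv
  have hcont : ∀ k : ι, ContinuousOn (fun v => MvPolynomial.aeval v (kernelNum W k) /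
      MvPolynomial.aeval v (kernelDen W k) : (Fin d → ℝ) → ℝ) (lexRegion d ε m) := fun k =>
    (continuous_aeval _).continuousOn.div (continuous_aeval _).continuousOn (hden0 k)
  refine ⟨kernelNum W l, kernelDen W l, l.2, hR.mono fun v hv => ?_⟩
  refine sub_eq_zero.1 (eq_zero_on_of_isPreconnected (isPreconnected_lexRegion hε)
    (g := fun v => matrixGameValue (evalMatrix W v) -
      MvPolynomial.aeval v (kernelNum W l) / MvPolynomial.aeval v (kernelDen W l))
    ((continuous_value_evalMatrix W).continuousOn.sub (hcont l))
    (f := fun (k : ι) v =>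
      MvPolynomial.aeval v (kernelNum W k) / MvPolynomial.aeval v (kernelDen W k) -
      MvPolynomial.aeval v (kernelNum W l) / MvPolynomial.aeval v (kernelDen W l))
    (fun k => (hcont k).sub (hcont l)) (fun v _ => ?_) (fun k => ?_) hv₀
    (sub_eq_zero.2 hl) v hv)
  · obtain ⟨k, hk⟩ := exists_kernel_evalMatrix W v
    exact ⟨k, by rw [hk]⟩
  · have hdiff : ∀ v ∈ lexRegion d ε m,
        MvPolynomial.aeval v (kernelNum W k) / MvPolynomial.aeval v (kernelDen W k) -
        MvPolynomial.aeval v (kernelNum W l) / MvPolynomial.aeval v (kernelDen W l) =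
        MvPolynomial.aeval v (kernelNum W k * kernelDen W l - kernelNum W l * kernelDen W k) /
          (MvPolynomial.aeval v (kernelDen W k) * MvPolynomial.aeval v (kernelDen W l)) := by
      intro v hv
      rw [div_sub_div _ _ (hden0 k v hv) (hden0 l v hv), map_sub, map_mul, map_mul,
        mul_comm (MvPolynomial.aeval v (kernelDen W k)) (MvPolynomial.aeval v (kernelNum W l))]
    by_cases h0 : kernelNum W k * kernelDen W l - kernelNum W l * kernelDen W k = 0
    · refine Or.inl fun v hv => ?_
      rw [hdiff v hv, h0, map_zero, zero_div]
    · refine Or.inr fun v hv => ?_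
      rw [hdiff v hv]
      exact div_ne_zero (aeval_ne_zero_of_mem_lexRegion h0 (hb (k, some l)) hε.le hεE hv)
        (mul_ne_zero (hden0 k v hv) (hden0 l v hv))

end PolynomialGame

/-! ### The auxiliary game as a matrix of integer polynomials. -/

section AuxiliaryGame

variable {S A₁ A₂ : Type*}

theorem sum_toStationary [Fintype A₁] [Fintype A₂]
    (σ : PureStationaryStrategy S A₁) (τ : PureStationaryStrategy S A₂) (t : S) (f : A₁ → A₂ → ℝ) :
    ∑ i, ∑ j, (σ.toStationary t : A₁ → ℝ) i * (τ.toStationary t : A₂ → ℝ) j * f i j =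
      f (σ t) (τ t) := by
  classical
  rw [Finset.sum_eq_single (σ t), Finset.sum_eq_single (τ t)]
  · simp [PureStationaryStrategy.toStationary]
  · intro j _ hj
    simp [PureStationaryStrategy.toStationary, hj]
  · simp
  · intro i _ hi
    simp [PureStationaryStrategy.toStationary, hi]
  · simp

variable [DecidableEq S] {d : ℕ}

/-- `N` times the matrix `Id - ((1 - Λ) 1ᵀ) ⊙ P`, where `N * P` is the integer matrix `k`. -/
def discountedPoly (N : ℕ) (k : S → S → ℤ) (χ : S → Fin d) :
    Matrix S S (MvPolynomial (Fin d) ℤ) :=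
  Matrix.of fun t t' => (if t = t' then MvPolynomial.C (N : ℤ) else 0) -
    (MvPolynomial.C (k t t') - MvPolynomial.X (χ t) * MvPolynomial.C (k t t'))

/-- The discounted matrix with the column `s` replaced by the integer rewards `l`. -/
def discountedPolyAt (N : ℕ) (k : S → S → ℤ) (l : S → ℤ) (χ : S → Fin d) (s : S) :
    Matrix S S (MvPolynomial (Fin d) ℤ) :=
  (discountedPoly N k χ).updateCol s fun t => MvPolynomial.X (χ t) * MvPolynomial.C (l t)

theorem polyBound_discountedPoly {N b : ℕ} (hN : N ≤ 2 ^ b) {k : S → S → ℤ}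
    (hk : ∀ t t', |k t t'| ≤ 2 ^ b) (χ : S → Fin d) (t t' : S) :
    PolyBound (discountedPoly N k χ t t') 1 (3 * 2 ^ b) := by
  have hk' : (k t t').natAbs ≤ 2 ^ b := by
    have := hk t t'
    zify
    exact this
  have h1 : PolyBound (if t = t' then MvPolynomial.C (N : ℤ) else 0 : MvPolynomial (Fin d) ℤ)
      1 (2 ^ b) := by
    split_ifs
    · exact (PolyBound.C _).mono (Nat.zero_le _) (by simpa using hN)
    · exact PolyBound.zero _ _
  have h2 : PolyBound (MvPolynomial.C (k t t') : MvPolynomial (Fin d) ℤ) 1 (2 ^ b) :=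
    (PolyBound.C _).mono (Nat.zero_le _) hk'
  have h3 : PolyBound (MvPolynomial.X (χ t) * MvPolynomial.C (k t t')) 1 (2 ^ b) :=
    ((PolyBound.X (χ t)).mul (PolyBound.C (k t t'))).mono le_rfl (by simpa using hk')
  exact (h1.sub (h2.sub h3)).mono le_rfl (by omega)

theorem polyBound_det_of_entries [Fintype S] {M : Matrix S S (MvPolynomial (Fin d) ℤ)} {b : ℕ}
    (h : ∀ t t', PolyBound (M t t') 1 (3 * 2 ^ b)) :
    PolyBound M.det (Fintype.card S)
      ((Fintype.card S).factorial * (3 * 2 ^ b) ^ Fintype.card S) := by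
  simpa using PolyBound.det (m := fun _ => 1) (E := fun _ => 3 * 2 ^ b) h

theorem polyBound_discountedPolyAt {N b : ℕ} (hN : N ≤ 2 ^ b) {k : S → S → ℤ}
    (hk : ∀ t t', |k t t'| ≤ 2 ^ b) {l : S → ℤ} (hl : ∀ t, |l t| ≤ 2 ^ b) (χ : S → Fin d)
    (s t t' : S) : PolyBound (discountedPolyAt N k l χ s t t') 1 (3 * 2 ^ b) := by
  have hl' : (l t).natAbs ≤ 2 ^ b := by
    have := hl t
    zify
    exact this
  rw [discountedPolyAt, Matrix.updateCol_apply]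
  split_ifs
  · exact ((PolyBound.X (χ t)).mul (PolyBound.C (l t))).mono le_rfl (by omega)
  · exact polyBound_discountedPoly hN hk χ t t'

/-- The auxiliary game, multiplied by a common denominator, as a matrix of integer polynomials. -/
def auxGamePoly [Fintype S] (N : ℕ) (k : S → A₁ → A₂ → S → ℤ) (l : S → A₁ → A₂ → ℤ)
    (χ : S → Fin d) (s : S) (z : ℚ) :
    Matrix (PureStationaryStrategy S A₁) (PureStationaryStrategy S A₂)
      (MvPolynomial (Fin d) ℤ) :=
  Matrix.of fun σ τ =>
    MvPolynomial.C (z.den : ℤ) *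
      (discountedPolyAt N (fun t => k t (σ t) (τ t)) (fun t => l t (σ t) (τ t)) χ s).det -
    MvPolynomial.C z.num * (discountedPoly N (fun t => k t (σ t) (τ t)) χ).det

theorem polyBound_auxGamePoly [Fintype S] {N b κ : ℕ} {k : S → A₁ → A₂ → S → ℤ}
    {l : S → A₁ → A₂ → ℤ}
    (hN : N ≤ 2 ^ b) (hk : ∀ t i j t', |k t i j t'| ≤ 2 ^ b)
    (hl : ∀ t i j, |l t i j| ≤ 2 ^ b) {z : ℚ} (hz : RatHasBitSize z κ) (χ : S → Fin d) (s : S)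
    (σ : PureStationaryStrategy S A₁) (τ : PureStationaryStrategy S A₂) :
    PolyBound (auxGamePoly N k l χ s z σ τ) (Fintype.card S)
      (2 * (2 ^ κ * ((Fintype.card S).factorial * (3 * 2 ^ b) ^ Fintype.card S))) := by
  have h1 := polyBound_det_of_entries
    (polyBound_discountedPoly hN (fun t t' => hk t (σ t) (τ t) t') χ)
  have h2 := polyBound_det_of_entries
    (polyBound_discountedPolyAt hN (fun t t' => hk t (σ t) (τ t) t')
      (fun t => hl t (σ t) (τ t)) χ s)
  rw [two_mul]
  refine PolyBound.sub ?_ ?_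
  · exact ((PolyBound.C _).mul h2).mono (by omega)
      (Nat.mul_le_mul_right _ (by simpa using hz.2))
  · exact ((PolyBound.C _).mul h1).mono (by omega) (Nat.mul_le_mul_right _ hz.1)

variable [Fintype S] [Fintype A₁] [Fintype A₂]

theorem ConcurrentGame.discountedMatrix_toStationary (G : ConcurrentGame S A₁ A₂) (Λ : S → ℝ)
    (σ : PureStationaryStrategy S A₁) (τ : PureStationaryStrategy S A₂) (t t' : S) :
    G.discountedMatrix Λ σ.toStationary τ.toStationary t t' =
      (if t = t' then 1 else 0) - (1 - Λ t) * (G.prob t (σ t) (τ t) : S → ℝ) t' := by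
  have h := sum_toStationary σ τ t fun i j => (G.prob t i j : S → ℝ) t'
  simp [ConcurrentGame.discountedMatrix, ConcurrentGame.transMatrix, Matrix.vecMulVec,
    Matrix.one_apply, h]

variable {G : ConcurrentGame S A₁ A₂} {r : S → A₁ → A₂ → ℝ} {N : ℕ}
  {k : S → A₁ → A₂ → S → ℤ} {l : S → A₁ → A₂ → ℤ}

theorem evalMatrix_discountedPoly (hN : N ≠ 0)
    (hk : ∀ t i j t', (G.prob t i j : S → ℝ) t' = (k t i j t' : ℝ) / (N : ℝ)) (χ : S → Fin d)
    (σ : PureStationaryStrategy S A₁) (τ : PureStationaryStrategy S A₂) (v : Fin d → ℝ) :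
    evalMatrix (discountedPoly N (fun t => k t (σ t) (τ t)) χ) v =
      (N : ℝ) • G.discountedMatrix (fun t => v (χ t)) σ.toStationary τ.toStationary := by
  have hN' : (N : ℝ) ≠ 0 := by exact_mod_cast hN
  ext t t'
  rw [Matrix.smul_apply, ConcurrentGame.discountedMatrix_toStationary, hk]
  simp only [evalMatrix, discountedPoly, Matrix.map_apply, Matrix.of_apply, map_sub, map_mul,
    MvPolynomial.aeval_X, MvPolynomial.algHom_C, smul_eq_mul]
  split_ifs
  · simp; field_simp
  · simp; field_simp; ring

theorem evalMatrix_discountedPolyAt (hN : N ≠ 0)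
    (hk : ∀ t i j t', (G.prob t i j : S → ℝ) t' = (k t i j t' : ℝ) / (N : ℝ))
    (hl : ∀ t i j, r t i j = (l t i j : ℝ) / (N : ℝ)) (χ : S → Fin d) (s : S)
    (σ : PureStationaryStrategy S A₁) (τ : PureStationaryStrategy S A₂) (v : Fin d → ℝ) :
    evalMatrix (discountedPolyAt N (fun t => k t (σ t) (τ t)) (fun t => l t (σ t) (τ t)) χ s) v =
      (N : ℝ) • (G.discountedMatrix (fun t => v (χ t)) σ.toStationary τ.toStationary).updateCol s
        ((fun t => v (χ t)) * stageReward r σ.toStationary τ.toStationary) := by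
  have hN' : (N : ℝ) ≠ 0 := by exact_mod_cast hN
  ext t t'
  by_cases h : t' = s
  · have h1 : stageReward r σ.toStationary τ.toStationary t = r t (σ t) (τ t) :=
      sum_toStationary σ τ t (r t)
    simp [evalMatrix, discountedPolyAt, h, h1, hl]
    field_simp
  · have := congrFun (congrFun (evalMatrix_discountedPoly hN hk χ σ τ v) t) t'
    simpa [evalMatrix, discountedPolyAt, Matrix.updateCol_apply, h] using this

/-- Each of the two determinants absorbs one factor `N` per state, and `z.den` clears the
denominator of `z`. The common factor is positive, so the sign of the value is unchanged. -/
theorem evalMatrix_auxGamePoly (hN : N ≠ 0)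
    (hk : ∀ t i j t', (G.prob t i j : S → ℝ) t' = (k t i j t' : ℝ) / (N : ℝ))
    (hl : ∀ t i j, r t i j = (l t i j : ℝ) / (N : ℝ)) (χ : S → Fin d) (s : S) (z : ℚ)
    (v : Fin d → ℝ) :
    evalMatrix (auxGamePoly N k l χ s z) v =
      ((z.den * N ^ Fintype.card S : ℕ) : ℝ) • G.auxGame r (fun t => v (χ t)) s (z : ℝ) := by
  have hz : (z.num : ℝ) = z.den * (z : ℝ) := by
    have : (z.den : ℝ) ≠ 0 := by exact_mod_cast z.den_nz
    rw [Rat.cast_def]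
    field_simp
  ext σ τ
  have h1 := congrArg Matrix.det (evalMatrix_discountedPoly hN hk χ σ τ v)
  have h2 := congrArg Matrix.det (evalMatrix_discountedPolyAt hN hk hl χ s σ τ v)
  rw [det_evalMatrix, Matrix.det_smul] at h1 h2
  simp only [evalMatrix, Matrix.map_apply, auxGamePoly, Matrix.of_apply, map_sub, map_mul, h1, h2,
    MvPolynomial.algHom_C, ConcurrentGame.auxGame, Matrix.smul_apply, ConcurrentGame.nabla,
    ConcurrentGame.nablaAt]
  simp [hz]
  ring

end AuxiliaryGame

/-! ### Numerical bounds and the explicit discount factors. -/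

section Estimates

theorem succ_le_two_pow_bitLength (k : ℕ) : k + 1 ≤ 2 ^ bitLength k := by
  have h : Real.logb 2 ((k : ℝ) + 1) ≤ bitLength k := Nat.le_ceil _
  rw [Real.logb_le_iff_le_rpow (by norm_num) (by positivity), Real.rpow_natCast] at h
  exact_mod_cast h

theorem one_le_bitLength {k : ℕ} (hk : 1 ≤ k) : 1 ≤ bitLength k := by
  by_contra h
  have h1 := succ_le_two_pow_bitLength k
  rw [show bitLength k = 0 by omega] at h1
  omega

theorem factorial_le_two_pow (n : ℕ) : n.factorial ≤ 2 ^ (n * bitLength n) := by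
  rw [mul_comm, pow_mul]
  exact (Nat.factorial_le_pow n).trans
    (Nat.pow_le_pow_left ((Nat.le_succ n).trans (succ_le_two_pow_bitLength n)) n)

theorem factorial_succ_le_pow (n : ℕ) : (n + 1).factorial ≤ (n + 1) ^ n := by
  induction n with
  | zero => simp
  | succ n ih =>
    rw [Nat.factorial_succ, pow_succ']
    exact Nat.mul_le_mul_left _ (ih.trans (Nat.pow_le_pow_left (Nat.le_succ _) n))

theorem factorial_succ_le_two_pow (n : ℕ) : (n + 1).factorial ≤ 2 ^ (n * bitLength n) := by
  rw [mul_comm, pow_mul]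
  exact (factorial_succ_le_pow n).trans (Nat.pow_le_pow_left (succ_le_two_pow_bitLength n) n)

/-- The left side is the coefficient bound F of the kernel polynomials. The constant 11 is not
sharp: the estimates below need only 4, attained at the `bitLength n` term. -/
theorem kernel_bound_le {n D b κ : ℕ} (hn : 1 ≤ n) :
    (D + 1).factorial * (2 * (2 ^ κ * (n.factorial * (3 * 2 ^ b) ^ n))) ^ D ≤
      2 ^ (11 * D * n * (b + bitLength n + bitLength D + κ)) := by
  have h1 : 2 * (2 ^ κ * (n.factorial * (3 * 2 ^ b) ^ n)) ≤
      2 ^ (1 + (κ + (n * bitLength n + (2 + b) * n))) := by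
    rw [pow_add, pow_add, pow_add, pow_one, pow_mul _ (2 + b), pow_add 2 2 b]
    gcongr
    · exact factorial_le_two_pow n
    · norm_num
  refine (Nat.mul_le_mul (factorial_succ_le_two_pow D) (Nat.pow_le_pow_left h1 D)).trans ?_
  rw [← pow_mul, ← pow_add]
  refine Nat.pow_le_pow_right two_pos ?_
  have hbn := one_le_bitLength hn
  generalize bitLength n = x at *
  generalize bitLength D = y at *
  have e1 : D * y ≤ D * n * y := Nat.mul_le_mul_right _ (Nat.le_mul_of_pos_right D hn)
  have e2 : D * κ ≤ D * n * κ := Nat.mul_le_mul_right _ (Nat.le_mul_of_pos_right D hn)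
  have e3 : D ≤ D * n * x :=
    (Nat.le_mul_of_pos_right D hn).trans (Nat.le_mul_of_pos_right _ hbn)
  have e4 : D * n ≤ D * n * x := Nat.le_mul_of_pos_right _ hbn
  calc D * y + (1 + (κ + (n * x + (2 + b) * n))) * D
      = D * y + D + D * κ + D * n * x + 2 * (D * n) + D * n * b := by ring
    _ ≤ D * n * y + D * n * x + D * n * κ + D * n * x + 2 * (D * n * x) + D * n * b := by omega
    _ ≤ 11 * (D * n * b + D * n * x + D * n * y + D * n * κ) := by omega
    _ = 11 * D * n * (b + x + y + κ) := by ring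

theorem exp_neg_mul_lt_one {B F : ℕ} (hB : B ≠ 0) (hF : F ≤ 2 ^ B) :
    Real.exp (-(B : ℝ)) * F < 1 := by
  have h1 : (F : ℝ) ≤ 2 ^ B := by exact_mod_cast hF
  have h2 : (2 : ℝ) ^ B < Real.exp B := by
    rw [← Real.exp_one_pow]
    exact pow_lt_pow_left₀ (by linarith [Real.exp_one_gt_d9]) (by norm_num) hB
  rw [Real.exp_neg, inv_mul_lt_iff₀ (Real.exp_pos _), mul_one]
  exact h1.trans_lt h2

/-- With m = nD, the geometric sum m ∑_{j<i} (m+1)^j = (m+1)^i - 1 turns every defining inequality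
into an equality; this dictates the exponents (nD+1)^{i-1}. -/
theorem explicitFactor_mem_lexRegion (n D b κ d : ℕ) :
    (explicitFactor n D b κ : Fin d → ℝ) ∈ lexRegion d
      (Real.exp (-((11 * D * n * (b + bitLength n + bitLength D + κ) : ℕ) : ℝ))) (n * D) := by
  intro i
  refine ⟨Real.exp_pos _, le_of_eq ?_⟩
  unfold explicitFactor
  generalize ((11 * D * n * (b + bitLength n + bitLength D + κ) : ℕ) : ℝ) = B
  set m : ℝ := (n : ℝ) * D with hm
  have hprod : (∏ j : Fin d, if j < i then Real.exp (-B * (m + 1) ^ (j : ℕ)) ^ (n * D) else 1) =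
      Real.exp (-B * ∑ j : Fin d, if (j : ℕ) < i then (m + 1) ^ (j : ℕ) * m else 0) := by
    rw [Finset.mul_sum, Real.exp_sum]
    refine Finset.prod_congr rfl fun j _ => ?_
    simp only [Fin.lt_def]
    split_ifs
    · rw [← Real.exp_nat_mul]
      congr 1
      push_cast
      rw [hm]
      ring
    · simp
  have hsum : ∑ j : Fin d, (if (j : ℕ) < i then (m + 1) ^ (j : ℕ) * m else 0) =
      (m + 1) ^ (i : ℕ) - 1 := by
    rw [Fin.sum_univ_eq_sum_range (fun j => if j < (i : ℕ) then (m + 1) ^ j * m else 0) d,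
      ← Finset.sum_filter]
    have : (Finset.range d).filter (· < (i : ℕ)) = Finset.range i := by
      ext j
      have := i.2
      simp only [Finset.mem_filter, Finset.mem_range]
      omega
    rw [this, ← Finset.sum_mul]
    simpa using geom_sum_mul (m + 1) (i : ℕ)
  rw [hprod, hsum, ← Real.exp_add]
  congr 1
  ring

end Estimates

end

/-! ### The lemma on the limit function. -/

theorem mainTheorem5 {S A₁ A₂ : Type*} [Fintype S] [DecidableEq S]
    [Fintype A₁] [Nonempty A₁] [Fintype A₂] [Nonempty A₂]
    (G : ConcurrentGame S A₁ A₂) (s : S) (r : S → A₁ → A₂ → ℝ)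
    {d : ℕ} [NeZero d] (χ : S → Fin d) (b κ : ℕ) (z : ℚ)
    (hG : G.HasBitSize r b) (hz : RatHasBitSize z κ)
    (D : ℕ) (hD : D = max (Nat.card (PureStationaryStrategy S A₁))
      (Nat.card (PureStationaryStrategy S A₂)))
    (lam₀ : Fin d → ℝ) (hlam₀ : lam₀ = explicitFactor (Fintype.card S) D b κ) :
    HasIteratedLimit d (G.limitRatio r χ s (z : ℝ)) (G.limitFunction r χ s (z : ℝ)) ∧
    (0 < matrixGameValue (G.auxGame r (fun t => lam₀ (χ t)) s (z : ℝ)) →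
      0 ≤ G.limitFunction r χ s (z : ℝ)) ∧
    (matrixGameValue (G.auxGame r (fun t => lam₀ (χ t)) s (z : ℝ)) < 0 →
      G.limitFunction r χ s (z : ℝ) ≤ 0) ∧
    (matrixGameValue (G.auxGame r (fun t => lam₀ (χ t)) s (z : ℝ)) = 0 →
      G.limitFunction r χ s (z : ℝ) = 0) := by
  have hn : 1 ≤ Fintype.card S := Fintype.card_pos_iff.2 ⟨s⟩
  obtain ⟨N, hN1, hN2, hk, hl⟩ := hG
  choose k hkb hk using hk
  choose l hlb hl using hl
  have hN0 : N ≠ 0 := by omega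
  classical
  have hcard : Fintype.card (PureStationaryStrategy S A₁) ≤ D := by
    rw [hD, ← Nat.card_eq_fintype_card]
    exact le_max_left _ _
  have hD1 : 1 ≤ D := (Fintype.card_pos (α := PureStationaryStrategy S A₁)).trans_le hcard
  set W := auxGamePoly N k l χ s z with hWdef
  set T : ℕ := z.den * N ^ Fintype.card S
  have hT : (0 : ℝ) < T := by
    have : 0 < T := Nat.mul_pos z.den_pos (pow_pos (by omega) _)
    exact_mod_cast this
  have hval : ∀ v : Fin d → ℝ, matrixGameValue (evalMatrix W v) =
      T * matrixGameValue (G.auxGame r (fun t => v (χ t)) s (z : ℝ)) := fun v => by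
    rw [hWdef, evalMatrix_auxGamePoly hN0 hk hl, matrixGameValue_smul _ hT]
  -- the limit exists
  have hlim : HasIteratedLimit d (G.limitRatio r χ s (z : ℝ)) (G.limitFunction r χ s (z : ℝ)) := by
    obtain ⟨p, q, hq, hpq⟩ := iteratedEventually_value_eq_div W
    have hT0 : (MvPolynomial.C (T : ℤ) : MvPolynomial (Fin d) ℤ) ≠ 0 := by
      rw [Ne, MvPolynomial.C_eq_zero]
      exact_mod_cast hT.ne'
    -- The scaling factor `T` and the normalization λ_d^n are put into the denominator, so the ratio
    -- is again a rational function over ℤ.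
    obtain ⟨L, hL⟩ := exists_hasIteratedLimit_aeval_div p
      (q * (MvPolynomial.C (T : ℤ) * MvPolynomial.X (⊤ : Fin d) ^ Fintype.card S))
      (mul_ne_zero hq (mul_ne_zero hT0 (pow_ne_zero _ (MvPolynomial.X_ne_zero _))))
    have hL' : HasIteratedLimit d (G.limitRatio r χ s (z : ℝ)) L := by
      refine hL.congr (hpq.mono fun v hv => ?_)
      rw [hval] at hv
      rw [ConcurrentGame.limitRatio, ← mul_div_cancel_left₀ (matrixGameValue _) hT.ne', hv]
      congr 1
      simp only [map_mul, map_pow, MvPolynomial.aeval_X, MvPolynomial.algHom_C, div_div]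
      simp [mul_assoc]
    rwa [← show G.limitFunction r χ s (z : ℝ) = L from hL'.iteratedLimit_eq] at hL'
  -- the sign at the explicit discount factors is the sign near the iterated limit
  set ε : ℝ := Real.exp
    (-((11 * D * Fintype.card S * (b + bitLength (Fintype.card S) + bitLength D + κ) : ℕ) : ℝ))
  have hε : 0 < ε := Real.exp_pos _
  have hB : 11 * D * Fintype.card S * (b + bitLength (Fintype.card S) + bitLength D + κ) ≠ 0 := by
    have := one_le_bitLength hD1
    have h1 : b + bitLength (Fintype.card S) + bitLength D + κ ≠ 0 := by omega
    exact mul_ne_zero (mul_ne_zero (mul_ne_zero (by norm_num) (by omega)) (by omega)) h1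
  have hmem : lam₀ ∈ lexRegion d ε (Fintype.card S * D) := by
    rw [hlam₀]
    exact explicitFactor_mem_lexRegion _ _ _ _ _
  have hsign := fun v (hv : v ∈ lexRegion d ε (Fintype.card S * D)) =>
    sign_value_evalMatrix (polyBound_auxGamePoly hN2 hkb hlb hz χ s)
      (by have := Nat.factorial_pos (Fintype.card S)
          exact Nat.one_le_iff_ne_zero.2 (by positivity)) hcard hε
      (exp_neg_mul_lt_one hB (kernel_bound_le hn)) hmem hv
  have hR := iteratedEventually_mem_lexRegion (Fintype.card S * D) d hε
  have hneg : ∀ x : ℝ, (T : ℝ) * x < 0 ↔ x < 0 := fun x => by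
    rw [mul_neg_iff]; simp [hT, hT.not_gt]
  simp only [← hWdef, hval, mul_pos_iff_of_pos_left hT, mul_eq_zero, hT.ne', false_or,
    hneg] at hsign
  have hpow : ∀ v ∈ lexRegion d ε (Fintype.card S * D),
      0 < v (⊤ : Fin d) ^ Fintype.card S := fun v hv => pow_pos (hv _).1 _
  -- The sign of the ratio on the region passes to the limit through the closed sets [0, ∞], [-∞, 0]
  -- and {0}; a strict sign survives only weakly.
  refine ⟨hlim, fun h => ?_, fun h => ?_, fun h => ?_⟩
  · exact hlim.mem_of_isClosed isClosed_Ici <| hR.mono fun v hv =>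
      EReal.coe_nonneg.2 (div_nonneg ((hsign v hv).2.1 h).le (hpow v hv).le)
  · exact hlim.mem_of_isClosed isClosed_Iic <| hR.mono fun v hv =>
      EReal.coe_nonpos.2 (div_nonpos_of_nonpos_of_nonneg ((hsign v hv).2.2 h).le (hpow v hv).le)
  · exact hlim.mem_of_isClosed (isClosed_singleton (x := (0 : EReal))) <| hR.mono fun v hv => by
      rw [Set.mem_singleton_iff, ConcurrentGame.limitRatio, (hsign v hv).1 h, zero_div,
        EReal.coe_zero]
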